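/- All systems are finite-dimensional with fixed orthonormal bases; "real" and the transpose $T$ refer to these bases. For states $\rho,\tau$ let $F(\rho,\tau)=\left[\operatorname{tr}\left(\sqrt{\tau}\,\rho\,\sqrt{\tau}\right)^{1/2}\right]^2$. Let $\mathscr I_g(\rho)=\frac12\bigl(1-\sqrt{F(\rho,\rho^T)}\bigr)$ be the geometric measure of imaginarity and $\mathscr I_c(\rho)=\max\{0,\lambda_1-\sum_{j>1}\lambda_j\}$ the concurrence of imaginarity, where $\lambda_1\ge\lambda_2\ge\dots$ are the eigenvalues, with multiplicity, of $\left(\sqrt\rho\,\rho^T\sqrt\rho\right)^{1/2}$. Let $\psi^{AB}$ be a bipartite pure state with $\rho^B=\operatorname{tr}_A|\psi\rangle\langle\psi|$, and let $\sigma^{B}$ be a target state of Bob (Bob's output space may differ from his input space). A one-way assisted protocol consists of a POVM $\{M_j\}$ with finitely many outcomes on Alice's system and, for each outcome $j$ (which Alice communicates to Bob), finitely many Kraus operators $K_{jk}$ on Bob's system with real entries and $\sum_k K_{jk}^\dagger K_{jk}\le\mathbb 1$, describing Bob's success branch. The protocol prepares $\sigma^B$ with probability $p$ if $$\sum_{j,k}K_{jk}\,\operatorname{tr}_A\left[(M_j\otimes\mathbb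 1)|\psi\rangle\langle\psi|\right]K_{jk}^\dagger=p\,\sigma^B .$$ Let $P(\psi^{AB}\to\sigma^B)$ be the largest such $p$ over all one-way assisted protocols. Then the maximum exists, and the following hold. 1. If $\sin^2\alpha=\frac12\left[1-\mathscr I_c(\rho^B)\right]$ and $\sin^2\beta=\mathscr I_g(\sigma^B)$ with $\alpha\in[0,\frac\pi2)$ and $\beta\in(0,\frac\pi2)$, then $$P(\psi^{AB}\to\sigma^B)=\min\left\{\frac{\sin^2\alpha}{\sin^2\beta},1\right\}.$$ 2. Equivalently, for every target $\sigma^B$ that is not real, $$P(\psi^{AB}\to\sigma^B)=\min\left\{\frac{1-\mathscr I_c(\rho^B)}{1-\sqrt{F(\sigma^B,(\sigma^B)^T)}},1\right\}.$$ 3. If $\sigma^B$ is real (the denominators vanish), then $P(\psi^{AB}\to\sigma^B)=1$. -/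

import Mathlib

open scoped MatrixOrder Kronecker ComplexOrder

namespace Imaginarity

/-- A density matrix in the fixed reference basis. -/
def IsDensityMatrix {n : Type*} [Fintype n] (ρ : Matrix n n ℂ) : Prop :=
  ρ.PosSemidef ∧ ρ.trace = 1

/-- All entries in the reference basis are real. -/
def IsRealMatrix {m n : Type*} (K : Matrix m n ℂ) : Prop :=
  ∀ i j, (K i j).im = 0

/-- The projector `|ψ⟩⟨ψ|`. -/
def pureState {n : Type*} (ψ : n → ℂ) : Matrix n n ℂ :=
  Matrix.vecMulVec ψ (star ψ)

/-- The partial trace over the first (Alice's) tensor factor. -/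
def traceAlice {A B : Type*} [Fintype A] (ρ : Matrix (A × B) (A × B) ℂ) : Matrix B B ℂ :=
  Matrix.of fun b b' => ∑ a, ρ (a, b) (a, b')

section Measures

variable {n : Type*} [Fintype n] [DecidableEq n]

/-- `(√σ ρ √σ)^{1/2}`. -/
noncomputable def rootOverlap (ρ σ : Matrix n n ℂ) : Matrix n n ℂ :=
  CFC.sqrt (CFC.sqrt σ * ρ * CFC.sqrt σ)

theorem rootOverlap_isHermitian (ρ σ : Matrix n n ℂ) : (rootOverlap ρ σ).IsHermitian :=
  (Matrix.nonneg_iff_posSemidef.mp (CFC.sqrt_nonneg _)).isHermitian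

/-- The fidelity `F(ρ, σ) = (tr (√σ ρ √σ)^{1/2})²`. -/
noncomputable def fidelity (ρ σ : Matrix n n ℂ) : ℝ :=
  (rootOverlap ρ σ).trace.re ^ 2

/-- The geometric measure of imaginarity `(1 - √F(ρ, ρᵀ)) / 2`. -/
noncomputable def geometricImaginarity (ρ : Matrix n n ℂ) : ℝ :=
  (1 - Real.sqrt (fidelity ρ ρ.transpose)) / 2

/-- The concurrence of imaginarity `max {0, λ₁ - ∑_{j > 1} λⱼ}`, where `λ₁ ≥ λ₂ ≥ …` are the
eigenvalues of `(√ρ ρᵀ √ρ)^{1/2}` counted with multiplicity. Mathlib's `eigenvalues₀` lists them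
in decreasing order with indices starting at `0`. -/
noncomputable def concurrenceImaginarity (ρ : Matrix n n ℂ) : ℝ :=
  max 0 (∑ j : Fin (Fintype.card n),
    if (j : ℕ) = 0 then (rootOverlap_isHermitian ρ.transpose ρ).eigenvalues₀ j
    else -(rootOverlap_isHermitian ρ.transpose ρ).eigenvalues₀ j)

end Measures

/-- A one-way protocol of local quantum operations by Alice, classical communication from Alice to
Bob, and local stochastic real operations by Bob. Alice performs the POVM `povm`; when she reports
outcome `j`, Bob applies the real, trace-nonincreasing operation with Kraus operators `kraus j k`.
The Kraus operators describe Bob's success branch. -/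
structure AssistedProtocol (A B B' : Type*) [Fintype A] [DecidableEq A] [Fintype B]
    [DecidableEq B] [Fintype B'] where
  outcomes : ℕ
  povm : Fin outcomes → Matrix A A ℂ
  povm_posSemidef : ∀ j, (povm j).PosSemidef
  povm_sum : ∑ j, povm j = 1
  krausRank : Fin outcomes → ℕ
  kraus : (j : Fin outcomes) → Fin (krausRank j) → Matrix B' B ℂ
  kraus_real : ∀ j k, IsRealMatrix (kraus j k)
  kraus_sum_le : ∀ j, ∑ k, (kraus j k).conjTranspose * kraus j k ≤ 1

section Protocol

variable {A B B' : Type*} [Fintype A] [DecidableEq A] [Fintype B] [DecidableEq B] [Fintype B']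

/-- Bob's unnormalised state `tr_A [(M ⊗ 1) ρ]` after Alice obtains the POVM element `M`. Its trace
is the probability of that outcome. -/
def steeredState (M : Matrix A A ℂ) (ρ : Matrix (A × B) (A × B) ℂ) : Matrix B B ℂ :=
  traceAlice ((M ⊗ₖ (1 : Matrix B B ℂ)) * ρ)

/-- Bob's unnormalised final state on success, with all classical records discarded. Its trace is
the success probability. -/
def AssistedProtocol.output (P : AssistedProtocol A B B') (ρ : Matrix (A × B) (A × B) ℂ) :
    Matrix B' B' ℂ :=
  ∑ j, ∑ k, P.kraus j k * steeredState (P.povm j) ρ * (P.kraus j k).conjTranspose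

/-- The probabilities `p` with which some assisted protocol turns `ψ` into `σ` on Bob's side. -/
def achievableProbabilities (ψ : A × B → ℂ) (σ : Matrix B' B' ℂ) : Set ℝ :=
  {p | ∃ P : AssistedProtocol A B B', P.output (pureState ψ) = (p : ℂ) • σ}

end Protocol

end Imaginarity

namespace Imaginarity

open Matrix

/-! Imaginarity is governed by the bilinear form `xᵀ y`: for a vector `v`, the nonnegative gap `‖v‖²
- |vᵀ v|` vanishes exactly when `v` is a phase times a real vector. Takagi factorisation of `√ρᵀ √ρ`
gives `ρ = Y Yᴴ` with `Yᵀ Y` diagonal; its entries `d i ≥ 0` are the eigenvalues of `(√ρ ρᵀ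
√ρ)^{1/2}`. Any other decomposition `ρ = V Vᴴ` has the form `V = Y C` with a contraction `C`, so `∑
|vⱼᵀ vⱼ|` lies between `2 max d - ∑ d` and `∑ d`. The upper end is `√F(ρ, ρᵀ)`; the lower end, cut
off at zero, is the concurrence of imaginarity.

Upper bound (`achievable_bound`): Alice's measurement decomposes `ρ^B`, and Bob's Kraus operators
turn the pieces into a decomposition of `p σ`. A real trace-nonincreasing operation cannot increase
the total gap (`real_operation_bound`). Comparing the two ends gives `p (1 - √F) ≤ 1 - I_c`, and the
trace gives `p ≤ 1`.

Attainment (`mem_achievable_of_weights`): Alice steers Bob into an ensemble all of whose vectors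
satisfy `vᵀ v = I_c ‖v‖²` (`exists_equalized_decomposition`). A real contraction takes each of them
to one qubit vector `(C, i S)` (`exists_real_compression`). From there a real operation produces the
columns of the bilinear-orthogonal `Y` of `σ`, either directly or multiplied by `i`, with two
adjustable weights (`exists_qubit_operation`). Suitable weights reach the bound. -/

/-! ### Takagi factorisation -/

/-- The antilinear map `J x = star (T x)` preserves the orthogonal complement of the vectors already
found, and its square is the linear map `Tᴴ T`. An eigenvector of `J²` in that complement is then
upgraded to one of `J` itself. -/
theorem exists_conjugate_eigenvector {n : Type*} [Fintype n] [DecidableEq n]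
    {T : Matrix n n ℂ} (hT : Tᵀ = T) {k : ℕ} (hk : k < Fintype.card n)
    (v : Fin k → n → ℂ) (d : Fin k → ℝ) (hv : ∀ i, T *ᵥ v i = (d i : ℂ) • star (v i)) :
    ∃ x : n → ℂ, ∃ μ : ℝ, star x ⬝ᵥ x = 1 ∧ (∀ i, star (v i) ⬝ᵥ x = 0) ∧ 0 ≤ μ ∧
      T *ᵥ x = (μ : ℂ) • star x := by
  have hsymm : ∀ x y : n → ℂ, x ⬝ᵥ T *ᵥ y = T *ᵥ x ⬝ᵥ y := fun x y => by
    rw [dotProduct_mulVec, ← mulVec_transpose, hT]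
  have hstar : ∀ x : n → ℂ, T *ᵥ star (T *ᵥ x) = star (Tᴴ *ᵥ (T *ᵥ x)) := fun x => by
    conv_rhs => rw [star_mulVec, conjTranspose_conjTranspose, ← mulVec_transpose, hT]
  have hperp : ∀ x : n → ℂ, (∀ i, star (v i) ⬝ᵥ x = 0) → ∀ i, v i ⬝ᵥ T *ᵥ x = 0 :=
    fun x hx i => by rw [hsymm, hv, smul_dotProduct, hx, smul_zero]
  have hperpJ : ∀ x : n → ℂ, (∀ i, star (v i) ⬝ᵥ x = 0) →
      ∀ i, star (v i) ⬝ᵥ star (T *ᵥ x) = 0 := fun x hx i => by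
    have := congrArg star (hperp x hx i)
    rwa [star_zero, ← star_dotProduct_star, dotProduct_comm] at this
  have hperpJJ : ∀ x : n → ℂ, (∀ i, star (v i) ⬝ᵥ x = 0) →
      ∀ i, star (v i) ⬝ᵥ (Tᴴ * T) *ᵥ x = 0 := fun x hx i => by
    have := hperpJ _ (hperpJ x hx) i
    rwa [hstar, star_star, mulVec_mulVec] at this
  obtain ⟨x, hx0, hxp, ν, hxe⟩ : ∃ x : n → ℂ, x ≠ 0 ∧ (∀ i, star (v i) ⬝ᵥ x = 0) ∧
      ∃ ν : ℂ, (Tᴴ * T) *ᵥ x = ν • x := by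
    set N : Submodule ℂ (n → ℂ) := LinearMap.ker (Matrix.of fun i => star (v i)).mulVecLin
    have hN : ∀ x, x ∈ N ↔ ∀ i, star (v i) ⬝ᵥ x = 0 := fun x => by
      simp only [N, LinearMap.mem_ker, mulVecLin_apply, funext_iff]; rfl
    have hne : N ≠ ⊥ := by
      apply LinearMap.ker_ne_bot_of_finrank_lt
      simpa using hk
    have : Nontrivial N := Submodule.nontrivial_iff_ne_bot.mpr hne
    have hmap : ∀ x ∈ N, (Tᴴ * T).mulVecLin x ∈ N := fun x hx =>
      (hN _).2 (hperpJJ x ((hN x).1 hx))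
    obtain ⟨ν, hν⟩ := Module.End.exists_eigenvalue ((Tᴴ * T).mulVecLin.restrict hmap)
    obtain ⟨x, hx⟩ := hν.exists_hasEigenvector
    refine ⟨x, fun h => hx.2 (Subtype.ext h), (hN _).1 x.2, ν, ?_⟩
    exact congrArg Subtype.val hx.apply_eq_smul
  have hpos : ∀ y : n → ℂ, y ≠ 0 → 0 < (star y ⬝ᵥ y).re ∧
      star y ⬝ᵥ y = ((star y ⬝ᵥ y).re : ℂ) := fun y hy => by
    have h := dotProduct_star_self_pos_iff.mpr hy
    rw [Complex.pos_iff] at h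
    exact ⟨h.1, Complex.ext rfl (by simpa using h.2.symm)⟩
  obtain ⟨μ, hμ0, hμ⟩ : ∃ μ : ℝ, 0 ≤ μ ∧ ν = (μ : ℂ) ^ 2 := by
    have h1 : ν * (star x ⬝ᵥ x) = star (T *ᵥ x) ⬝ᵥ T *ᵥ x := by
      rw [← smul_eq_mul, ← dotProduct_smul, ← hxe, star_mulVec, ← dotProduct_mulVec, mulVec_mulVec]
    have h2 : 0 ≤ star (T *ᵥ x) ⬝ᵥ T *ᵥ x := dotProduct_star_self_nonneg _
    rw [← h1, (hpos x hx0).2, mul_comm, Complex.nonneg_iff] at h2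
    simp only [Complex.re_ofReal_mul, Complex.im_ofReal_mul] at h2
    have h3 := (hpos x hx0).1
    refine ⟨√ν.re, Real.sqrt_nonneg _, ?_⟩
    rw [← Complex.ofReal_pow, Real.sq_sqrt (nonneg_of_mul_nonneg_right h2.1 h3)]
    refine Complex.ext rfl ?_
    have := h2.2
    rw [eq_comm, mul_eq_zero] at this
    simpa using this.resolve_left h3.ne'
  have hJJ : T *ᵥ star (T *ᵥ x) = ((μ : ℂ) ^ 2) • star x := by
    rw [hstar, mulVec_mulVec, hxe, hμ]; simp [star_smul]
  obtain ⟨y, hy0, hyp, hye⟩ : ∃ y : n → ℂ, y ≠ 0 ∧ (∀ i, star (v i) ⬝ᵥ y = 0) ∧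
      T *ᵥ y = (μ : ℂ) • star y := by
    -- `J x + μ x` is fixed by `J` up to the factor `μ`. If it vanishes, then `J x = -μ x`, and
    -- antilinearity makes `i x` an eigenvector for `+μ`.
    by_cases h : star (T *ᵥ x) + (μ : ℂ) • x = 0
    · refine ⟨Complex.I • x, by simpa using hx0, fun i => by rw [dotProduct_smul, hxp, smul_zero], ?_⟩
      have h2 : T *ᵥ x = -((μ : ℂ) • star x) := by
        have := congrArg star (eq_neg_of_add_eq_zero_left h)
        simpa [star_smul] using this
      rw [mulVec_smul, h2]
      ext a
      simp
      ring
    · refine ⟨_, h, fun i => by rw [dotProduct_add, hperpJ x hxp, dotProduct_smul, hxp]; simp, ?_⟩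
      rw [mulVec_add, hJJ, mulVec_smul]
      ext a
      simp
      ring
  obtain ⟨hr, hr'⟩ := hpos y hy0
  set r := (star y ⬝ᵥ y).re
  refine ⟨((√r)⁻¹ : ℂ) • y, μ, ?_, fun i => by rw [dotProduct_smul, hyp, smul_zero], hμ0, ?_⟩
  · rw [star_smul, smul_dotProduct, dotProduct_smul, hr']
    have h1 : ((√r : ℝ) : ℂ) ≠ 0 := by exact_mod_cast (Real.sqrt_pos.2 hr).ne'
    have h2 : (r : ℂ) = (√r : ℂ) * √r := by
      rw [← Complex.ofReal_mul, Real.mul_self_sqrt hr.le]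
    simp only [smul_eq_mul, star_inv₀, RCLike.star_def, Complex.conj_ofReal]
    rw [h2]; field_simp
  · rw [mulVec_smul, hye, star_smul, smul_comm]
    simp

/-- Autonne–Takagi factorisation of a complex symmetric matrix. -/
theorem exists_takagi {n : Type*} [Fintype n] [DecidableEq n]
    {T : Matrix n n ℂ} (hT : Tᵀ = T) :
    ∃ V : Matrix n n ℂ, ∃ d : n → ℝ, Vᴴ * V = 1 ∧ V * Vᴴ = 1 ∧ (∀ i, 0 ≤ d i) ∧
      Vᵀ * T * V = diagonal fun i => (d i : ℂ) := by
  have key : ∀ k ≤ Fintype.card n, ∃ (v : Fin k → n → ℂ) (d : Fin k → ℝ),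
      (∀ i j, star (v i) ⬝ᵥ v j = if i = j then 1 else 0) ∧ (∀ i, 0 ≤ d i) ∧
      ∀ i, T *ᵥ v i = (d i : ℂ) • star (v i) := by
    intro k
    induction k with
    | zero => exact fun _ => ⟨Fin.elim0, Fin.elim0, fun i => i.elim0, fun i => i.elim0,
        fun i => i.elim0⟩
    | succ k ih =>
      intro hk
      obtain ⟨v, d, ho, hd, hv⟩ := ih (by omega)
      obtain ⟨x, μ, hx1, hxp, hμ, hxe⟩ := exists_conjugate_eigenvector hT hk v d hv
      have hxp' : ∀ i, star x ⬝ᵥ v i = 0 := fun i => by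
        rw [← star_star (v i), star_dotProduct_star, hxp, star_zero]
      refine ⟨Fin.snoc (α := fun _ => n → ℂ) v x, Fin.snoc (α := fun _ => ℝ) d μ, ?_, ?_, ?_⟩
      · intro i j
        refine Fin.lastCases ?_ (fun i => ?_) i <;> refine Fin.lastCases ?_ (fun j => ?_) j
        · simp [hx1]
        · simp [hxp', (Fin.castSucc_lt_last j).ne']
        · simp [hxp, (Fin.castSucc_lt_last i).ne]
        · simp [ho]
      · exact fun i => Fin.lastCases (by simpa using hμ) (fun i => by simpa using hd i) i
      · exact fun i => Fin.lastCases (by simpa using hxe) (fun i => by simpa using hv i) i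
  obtain ⟨v, d, ho, hd, hv⟩ := key _ le_rfl
  let e := Fintype.equivFin n
  have hV : (Matrix.of fun i j => v (e j) i)ᴴ * (Matrix.of fun i j => v (e j) i) = 1 := by
    ext i j
    have := ho (e i) (e j)
    simpa [one_apply, mul_apply, dotProduct] using this
  refine ⟨Matrix.of fun i j => v (e j) i, fun i => d (e i), hV, mul_eq_one_comm.1 hV,
    fun i => hd _, ?_⟩
  ext i j
  have h1 : (T * Matrix.of fun i j => v (e j) i) = Matrix.of fun i j => (d (e j) : ℂ) * star (v (e j) i) := by
    ext a b
    have := congrFun (hv (e b)) a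
    simpa [mul_apply, mulVec, dotProduct] using this
  rw [Matrix.mul_assoc, h1]
  have := ho (e j) (e i)
  simp only [mul_apply, transpose_apply, of_apply, diagonal_apply]
  have h2 : ∑ x, v (e i) x * ((d (e j) : ℂ) * star (v (e j) x)) = d (e j) * (star (v (e j)) ⬝ᵥ v (e i)) := by
    rw [dotProduct, Finset.mul_sum]
    exact Finset.sum_congr rfl fun x _ => by simp only [Pi.star_apply]; ring
  rw [h2, this]
  by_cases h : i = j
  · simp [h]
  · simp [h, Ne.symm h]

/-! ### Eigenvalues and bilinear-orthogonal decompositions -/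

theorem sqrt_transpose {n : Type*} [Fintype n] [DecidableEq n] {M : Matrix n n ℂ}
    (hM : M.PosSemidef) : CFC.sqrt Mᵀ = (CFC.sqrt M)ᵀ := by
  have h0 : (CFC.sqrt M)ᵀ.PosSemidef :=
    (Matrix.nonneg_iff_posSemidef.mp (CFC.sqrt_nonneg M)).transpose
  have h1 : (0 : Matrix n n ℂ) ≤ M := Matrix.nonneg_iff_posSemidef.mpr hM
  refine CFC.sqrt_unique ?_ (Matrix.nonneg_iff_posSemidef.mpr h0)
  rw [← transpose_mul, CFC.sqrt_mul_sqrt_self M h1]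

/-- The ordered eigenvalues and `d` are the same multiset, namely the roots of the characteristic
polynomial, so the first ordered eigenvalue is a maximal `d i₀`. This frees the concurrence from any
ordering. -/
theorem sum_signed_eigenvalues {n : Type*} [Fintype n] [DecidableEq n] [Nonempty n]
    {H V : Matrix n n ℂ} {d : n → ℝ} (hH : H.IsHermitian) (hV : Vᴴ * V = 1)
    (h : H = V * diagonal (fun i => (d i : ℂ)) * Vᴴ) :
    ∃ i₀, (∀ i, d i ≤ d i₀) ∧ (∑ j : Fin (Fintype.card n),
      if (j : ℕ) = 0 then hH.eigenvalues₀ j else -hH.eigenvalues₀ j) = 2 * d i₀ - ∑ i, d i := by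
  have hroots : H.charpoly.roots = Multiset.map (Complex.ofReal ∘ d) Finset.univ.val := by
    rw [h, Matrix.mul_assoc, charpoly_mul_comm, Matrix.mul_assoc, hV, Matrix.mul_one,
      charpoly_diagonal, Polynomial.roots_prod _ _ (Finset.prod_ne_zero_iff.2 fun i _ =>
        Polynomial.X_sub_C_ne_zero _)]
    simp only [Polynomial.roots_X_sub_C, Multiset.bind_singleton]
    rfl
  have hms : Multiset.map hH.eigenvalues₀ Finset.univ.val = Multiset.map d Finset.univ.val := by
    have := hH.roots_charpoly_eq_eigenvalues₀.symm.trans hroots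
    apply Multiset.map_injective Complex.ofReal_injective
    rw [Multiset.map_map, Multiset.map_map]
    exact this
  have hsum : ∑ j, hH.eigenvalues₀ j = ∑ i, d i := congrArg Multiset.sum hms
  let z : Fin (Fintype.card n) := ⟨0, Fintype.card_pos⟩
  obtain ⟨i₀, hi₀⟩ : ∃ i, d i = hH.eigenvalues₀ z := by
    have : hH.eigenvalues₀ z ∈ Multiset.map d Finset.univ.val := by
      rw [← hms]; exact Multiset.mem_map_of_mem _ (Finset.mem_univ z)
    obtain ⟨i, -, hi⟩ := Multiset.mem_map.1 this
    exact ⟨i, hi⟩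
  refine ⟨i₀, fun i => ?_, ?_⟩
  · have : d i ∈ Multiset.map hH.eigenvalues₀ Finset.univ.val := by
      rw [hms]; exact Multiset.mem_map_of_mem _ (Finset.mem_univ i)
    obtain ⟨j, -, hj⟩ := Multiset.mem_map.1 this
    rw [← hj, hi₀]
    exact hH.eigenvalues₀_antitone (Nat.zero_le _)
  · rw [← hsum, hi₀]
    have : ∀ j : Fin (Fintype.card n),
        (if (j : ℕ) = 0 then hH.eigenvalues₀ j else -hH.eigenvalues₀ j) =
          (if j = z then 2 * hH.eigenvalues₀ z else 0) - hH.eigenvalues₀ j := fun j => by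
      by_cases hj : j = z
      · subst hj; simp [z]; ring
      · have : (j : ℕ) ≠ 0 := fun h => hj (Fin.ext h)
        simp [hj, this]
    simp only [this, Finset.sum_sub_distrib, Finset.sum_ite_eq', Finset.mem_univ, if_true]

/-- A decomposition of `ρ` into vectors that are orthogonal for the bilinear form `xᵀ y`. -/
theorem exists_bilinear_orthogonal_decomposition {n : Type*} [Fintype n] [DecidableEq n]
    {ρ : Matrix n n ℂ} (hρ : ρ.PosSemidef) :
    ∃ (Y : Matrix n n ℂ) (d : n → ℝ), (∀ i, 0 ≤ d i) ∧ Y * Yᴴ = ρ ∧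
      Yᵀ * Y = diagonal (fun i => (d i : ℂ)) ∧ √(fidelity ρ ρᵀ) = ∑ i, d i ∧
      (Nonempty n → ∃ i₀, (∀ i, d i ≤ d i₀) ∧
        concurrenceImaginarity ρ = max 0 (2 * d i₀ - ∑ i, d i)) := by
  set X := CFC.sqrt ρ with hXdef
  have hXp : X.PosSemidef := Matrix.nonneg_iff_posSemidef.mp (CFC.sqrt_nonneg ρ)
  have hX : Xᴴ = X := hXp.isHermitian
  have hXX : X * X = ρ := CFC.sqrt_mul_sqrt_self ρ (Matrix.nonneg_iff_posSemidef.mpr hρ)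
  obtain ⟨V, d, hV, hV', hd, hT⟩ := exists_takagi (T := Xᵀ * X) (by
    rw [transpose_mul, transpose_transpose])
  set D : Matrix n n ℂ := diagonal fun i => (d i : ℂ)
  have hD : Dᴴ = D := by
    simp only [D, diagonal_conjTranspose]
    congr 1; ext i; simp
  have hXt : Xᵀᴴ = Xᵀ := hXp.transpose.isHermitian
  have hVc : Vᵀᴴ * Vᵀ = 1 := by
    have := congrArg transpose hV'
    rw [transpose_mul, transpose_one] at this
    exact this
  -- With `T = Xᵀ X` one has `Tᴴ T = X ρᵀ X`, so the Takagi basis diagonalises the matrix under the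
  -- root.
  have hDD : Vᴴ * (X * ρᵀ * X) * V = D * D := by
    calc Vᴴ * (X * ρᵀ * X) * V = (Vᵀ * (Xᵀ * X) * V)ᴴ * (Vᵀ * (Xᵀ * X) * V) := by
          rw [← hXX]
          simp only [conjTranspose_mul, hX, hXt, transpose_mul, Matrix.mul_assoc]
          rw [← Matrix.mul_assoc Vᵀᴴ, hVc, Matrix.one_mul]
      _ = D * D := by rw [hT, hD]
  have hDp : D.PosSemidef := by
    rw [posSemidef_diagonal_iff]
    exact fun i => by simpa using hd i
  have hroot : rootOverlap ρᵀ ρ = V * D * Vᴴ := by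
    refine CFC.sqrt_unique ?_ (Matrix.nonneg_iff_posSemidef.mpr
      (hDp.mul_mul_conjTranspose_same V))
    calc V * D * Vᴴ * (V * D * Vᴴ) = V * (D * (Vᴴ * V) * D) * Vᴴ := by
          simp only [Matrix.mul_assoc]
      _ = (V * Vᴴ) * (X * ρᵀ * X) * (V * Vᴴ) := by
          rw [hV, Matrix.mul_one, ← hDD]; simp only [Matrix.mul_assoc]
      _ = _ := by rw [hV', Matrix.one_mul, Matrix.mul_one]
  -- The fidelity and the concurrence take the two states in opposite orders; a transpose relates
  -- the two roots and preserves the trace.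
  have hroot' : rootOverlap ρ ρᵀ = (rootOverlap ρᵀ ρ)ᵀ := by
    unfold rootOverlap
    have hp : (X * ρᵀ * X).PosSemidef := by
      have := hρ.transpose.mul_mul_conjTranspose_same X
      rwa [hX] at this
    rw [sqrt_transpose hρ, ← hXdef, ← sqrt_transpose hp]
    simp only [transpose_mul, transpose_transpose, Matrix.mul_assoc]
  refine ⟨X * V, d, hd, ?_, ?_, ?_, fun hn => ?_⟩
  · rw [conjTranspose_mul, hX, Matrix.mul_assoc, ← Matrix.mul_assoc V, hV', Matrix.one_mul, hXX]
  · refine Eq.trans ?_ hT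
    rw [transpose_mul]; simp only [Matrix.mul_assoc]
  · have htr : (rootOverlap ρ ρᵀ).trace.re = ∑ i, d i := by
      rw [hroot', trace_transpose, hroot, trace_mul_comm, ← Matrix.mul_assoc, hV, Matrix.one_mul,
        trace_diagonal, Complex.re_sum]
      simp
    rw [fidelity, htr, Real.sqrt_sq (Finset.sum_nonneg fun i _ => hd i)]
  · obtain ⟨i₀, hi, h⟩ := sum_signed_eigenvalues (rootOverlap_isHermitian ρᵀ ρ) hV hroot
    exact ⟨i₀, hi, by rw [concurrenceImaginarity, h]⟩

/-! ### Comparing decompositions of one matrix -/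

theorem exists_pseudoinverse {n : Type*} [Fintype n] [DecidableEq n] {ρ : Matrix n n ℂ}
    (hρ : ρ.IsHermitian) : ∃ R : Matrix n n ℂ, Rᴴ = R ∧ ρ * R * ρ = ρ ∧ R * ρ * R = R := by
  set U : Matrix n n ℂ := (hρ.eigenvectorUnitary : Matrix n n ℂ)
  have hU : Uᴴ * U = 1 := Unitary.coe_star_mul_self hρ.eigenvectorUnitary
  set e := hρ.eigenvalues
  have h : ρ = U * diagonal (fun i => (e i : ℂ)) * Uᴴ := by
    conv_lhs => rw [hρ.spectral_theorem]
    rw [Unitary.conjStarAlgAut_apply]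
    rfl
  have hmul : ∀ D E F : Matrix n n ℂ, U * D * Uᴴ * (U * E * Uᴴ) * (U * F * Uᴴ) =
      U * (D * E * F) * Uᴴ := fun D E F => by
    calc _ = U * D * (Uᴴ * U) * E * (Uᴴ * U) * F * Uᴴ := by simp only [Matrix.mul_assoc]
      _ = _ := by rw [hU]; simp only [Matrix.mul_one, Matrix.mul_assoc]
  -- The convention `0⁻¹ = 0` makes this the pseudoinverse on the kernel as well.
  refine ⟨U * diagonal (fun i => ((e i)⁻¹ : ℂ)) * Uᴴ, ?_, ?_, ?_⟩
  · simp only [conjTranspose_mul, conjTranspose_conjTranspose, diagonal_conjTranspose,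
      Matrix.mul_assoc]
    congr 3; ext i; simp
  · rw [h, hmul]
    simp only [diagonal_mul_diagonal]
    congr 3; ext i; by_cases hi : (e i : ℂ) = 0 <;> simp [hi]
  · rw [h, hmul]
    simp only [diagonal_mul_diagonal]
    congr 3; ext i; by_cases hi : (e i : ℂ) = 0 <;> simp [hi]

/-- Two decompositions of the same positive matrix are related by a contraction. -/
theorem exists_contraction {n m l : Type*} [Fintype n] [DecidableEq n] [Fintype m] [DecidableEq m]
    [Fintype l] {Y : Matrix n m ℂ} {V : Matrix n l ℂ} (h : V * Vᴴ = Y * Yᴴ) :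
    ∃ C : Matrix m l ℂ, V = Y * C ∧ Y * (C * Cᴴ) = Y ∧ C * Cᴴ ≤ 1 := by
  have hρ : (Y * Yᴴ).IsHermitian := isHermitian_mul_conjTranspose_self Y
  obtain ⟨R, hR, h1, h2⟩ := exists_pseudoinverse hρ
  set ρ := Y * Yᴴ with hρdef
  have key : (ρ * R - 1) * ρ = 0 := by rw [Matrix.sub_mul, h1, Matrix.one_mul, sub_self]
  have hY : ρ * R * Y = Y := by
    have he : ρ * R * Y - Y = (ρ * R - 1) * Y := by rw [Matrix.sub_mul, Matrix.one_mul]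
    rw [← sub_eq_zero, ← self_mul_conjTranspose_eq_zero]
    calc _ = (ρ * R - 1) * ρ * (ρ * R - 1)ᴴ := by
          rw [he, conjTranspose_mul, hρdef]; simp only [Matrix.mul_assoc]
      _ = 0 := by rw [key, Matrix.zero_mul]
  have hV : ρ * R * V = V := by
    have he : ρ * R * V - V = (ρ * R - 1) * V := by rw [Matrix.sub_mul, Matrix.one_mul]
    rw [← sub_eq_zero, ← self_mul_conjTranspose_eq_zero]
    calc _ = (ρ * R - 1) * (V * Vᴴ) * (ρ * R - 1)ᴴ := by
          rw [he, conjTranspose_mul]; simp only [Matrix.mul_assoc]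
      _ = 0 := by rw [h, key, Matrix.zero_mul]
  -- The contraction is `C = Yᴴ R V`; then `C Cᴴ = Yᴴ R Y` is an orthogonal projection that acts
  -- trivially under `Y`.
  have hC : Yᴴ * R * V * (Yᴴ * R * V)ᴴ = Yᴴ * R * Y := by
    calc _ = Yᴴ * (R * (V * Vᴴ) * R) * Y := by
          simp only [conjTranspose_mul, conjTranspose_conjTranspose, hR, Matrix.mul_assoc]
      _ = _ := by rw [h, h2]
  have hP : (Yᴴ * R * Y)ᴴ = Yᴴ * R * Y := by
    simp only [conjTranspose_mul, conjTranspose_conjTranspose, hR, Matrix.mul_assoc]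
  have hPP : Yᴴ * R * Y * (Yᴴ * R * Y) = Yᴴ * R * Y := by
    calc _ = Yᴴ * (R * (Y * Yᴴ) * R) * Y := by simp only [Matrix.mul_assoc]
      _ = _ := by rw [← hρdef, h2]
  refine ⟨Yᴴ * R * V, ?_, ?_, ?_⟩
  · rw [← Matrix.mul_assoc, ← Matrix.mul_assoc, ← hρdef, hV]
  · rw [hC, ← Matrix.mul_assoc, ← Matrix.mul_assoc, ← hρdef, hY]
  · rw [hC, Matrix.le_iff]
    have := posSemidef_conjTranspose_mul_self (1 - Yᴴ * R * Y)
    rwa [conjTranspose_sub, hP, conjTranspose_one, Matrix.sub_mul, Matrix.mul_sub, Matrix.mul_sub,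
      hPP, Matrix.one_mul, Matrix.one_mul, Matrix.mul_one, sub_self, sub_zero] at this

section Bounds

variable {n m l : Type*} [Fintype n] [DecidableEq n] [Fintype m] [DecidableEq m] [Fintype l]
  {Y : Matrix n m ℂ} {V : Matrix n l ℂ} {d : m → ℝ}

/-- Writing `V = Y C`, the cross terms of `vⱼᵀ vⱼ` vanish by bilinear orthogonality. Rows of `C`
need not be unit vectors, but `Y C Cᴴ = Y` makes them so wherever `d i ≠ 0`. -/
theorem exists_weights (hY : Yᵀ * Y = diagonal (fun i => (d i : ℂ))) (h : V * Vᴴ = Y * Yᴴ) :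
    ∃ C : Matrix m l ℂ, (∀ j, (Vᵀ * V) j j = ∑ i, (d i : ℂ) * C i j ^ 2) ∧
      ∀ i, ∑ j, d i * ‖C i j‖ ^ 2 = d i := by
  obtain ⟨C, hVC, hYC, -⟩ := exists_contraction h
  refine ⟨C, fun j => ?_, fun i => ?_⟩
  · have : Vᵀ * V = Cᵀ * (diagonal (fun i => (d i : ℂ)) * C) := by
      rw [← hY, hVC, transpose_mul]; simp only [Matrix.mul_assoc]
    rw [this, mul_apply]
    refine Finset.sum_congr rfl fun i _ => ?_
    rw [diagonal_mul, transpose_apply]; ring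
  · have : diagonal (fun i => (d i : ℂ)) * (C * Cᴴ) = diagonal (fun i => (d i : ℂ)) := by
      rw [← hY, Matrix.mul_assoc, hYC]
    have := congrFun (congrFun this i) i
    rw [diagonal_mul, diagonal_apply_eq, mul_apply] at this
    rw [← Finset.mul_sum]
    have h2 : ((∑ j, ‖C i j‖ ^ 2 : ℝ) : ℂ) = ∑ j, C i j * Cᴴ j i := by
      rw [Complex.ofReal_sum]
      refine Finset.sum_congr rfl fun j _ => ?_
      rw [conjTranspose_apply, RCLike.star_def, Complex.mul_conj']
      norm_cast
    rw [← h2] at this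
    exact_mod_cast this

theorem sum_norm_bilinear_le (hd : ∀ i, 0 ≤ d i) (hY : Yᵀ * Y = diagonal (fun i => (d i : ℂ)))
    (h : V * Vᴴ = Y * Yᴴ) : ∑ j, ‖(Vᵀ * V) j j‖ ≤ ∑ i, d i := by
  obtain ⟨C, h1, h2⟩ := exists_weights hY h
  calc ∑ j, ‖(Vᵀ * V) j j‖ ≤ ∑ j, ∑ i, d i * ‖C i j‖ ^ 2 := by
        refine Finset.sum_le_sum fun j _ => ?_
        rw [h1]
        refine (norm_sum_le _ _).trans (Finset.sum_le_sum fun i _ => ?_)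
        simp [abs_of_nonneg (hd i)]
    _ = ∑ i, d i := by
        rw [Finset.sum_comm]; exact Finset.sum_congr rfl fun i _ => h2 i

/-- Reverse triangle inequality in each column: the `i₀` term minus all the others, summed over the
columns. -/
theorem le_sum_norm_bilinear (hd : ∀ i, 0 ≤ d i) (hY : Yᵀ * Y = diagonal (fun i => (d i : ℂ)))
    (h : V * Vᴴ = Y * Yᴴ) (i₀ : m) : 2 * d i₀ - ∑ i, d i ≤ ∑ j, ‖(Vᵀ * V) j j‖ := by
  obtain ⟨C, h1, h2⟩ := exists_weights hY h
  calc 2 * d i₀ - ∑ i, d i = ∑ j, (2 * (d i₀ * ‖C i₀ j‖ ^ 2) - ∑ i, d i * ‖C i j‖ ^ 2) := by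
        rw [Finset.sum_sub_distrib, Finset.sum_comm, ← Finset.mul_sum, h2]
        simp only [h2]
    _ ≤ ∑ j, ‖(Vᵀ * V) j j‖ := by
        refine Finset.sum_le_sum fun j _ => ?_
        rw [h1, ← Finset.add_sum_erase _ _ (Finset.mem_univ i₀),
          ← Finset.add_sum_erase _ (fun i => (d i : ℂ) * C i j ^ 2) (Finset.mem_univ i₀)]
        have h3 := norm_sub_le_norm_add ((d i₀ : ℂ) * C i₀ j ^ 2)
          (∑ i ∈ Finset.univ.erase i₀, (d i : ℂ) * C i j ^ 2)
        have h4 : ‖∑ i ∈ Finset.univ.erase i₀, (d i : ℂ) * C i j ^ 2‖ ≤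
            ∑ i ∈ Finset.univ.erase i₀, d i * ‖C i j‖ ^ 2 := by
          refine (norm_sum_le _ _).trans (Finset.sum_le_sum fun i _ => ?_)
          simp [abs_of_nonneg (hd i)]
        have h5 : ‖(d i₀ : ℂ) * C i₀ j ^ 2‖ = d i₀ * ‖C i₀ j‖ ^ 2 := by
          simp [abs_of_nonneg (hd i₀)]
        linarith

end Bounds

/-! ### Monotonicity under real operations -/

theorem exists_eq_conjTranspose_mul_self {n : Type*} [Fintype n] [DecidableEq n]
    {M : Matrix n n ℂ} (hM : M.PosSemidef) : ∃ L : Matrix n n ℂ, M = Lᴴ * L := by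
  refine ⟨CFC.sqrt M, ?_⟩
  rw [(Matrix.nonneg_iff_posSemidef.mp (CFC.sqrt_nonneg M)).isHermitian.eq,
    CFC.sqrt_mul_sqrt_self M (Matrix.nonneg_iff_posSemidef.mpr hM)]

theorem norm_dotProduct_le {n : Type*} [Fintype n] (x y : n → ℂ) :
    ‖x ⬝ᵥ y‖ ≤ ((star x ⬝ᵥ x).re + (star y ⬝ᵥ y).re) / 2 := by
  have hsq : ∀ x : n → ℂ, (star x ⬝ᵥ x).re = ∑ i, ‖x i‖ ^ 2 := fun x => by
    rw [dotProduct, Complex.re_sum]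
    refine Finset.sum_congr rfl fun i _ => ?_
    rw [Pi.star_apply, RCLike.star_def, Complex.conj_mul']
    norm_cast
  rw [hsq, hsq, ← Finset.sum_add_distrib, Finset.sum_div]
  refine (norm_sum_le _ _).trans (Finset.sum_le_sum fun i _ => ?_)
  rw [norm_mul]
  nlinarith [sq_nonneg (‖x i‖ - ‖y i‖)]

theorem IsRealMatrix.map_star {m n : Type*} {K : Matrix m n ℂ} (hK : IsRealMatrix K) :
    K.map star = K := by
  ext i j
  exact Complex.conj_eq_iff_im.2 (hK i j)

theorem IsRealMatrix.conjTranspose_eq {m n : Type*} {K : Matrix m n ℂ} (hK : IsRealMatrix K) :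
    Kᴴ = Kᵀ := by
  conv_rhs => rw [← hK.map_star]
  rfl

/-- With `E = Lᴴ L`, the left side is the overlap of `L v̄` and `L v`. Since `E` is real, these two
vectors have equal norm. -/
theorem norm_bilinear_le {n : Type*} [Fintype n] [DecidableEq n] {E : Matrix n n ℂ}
    (hE : E.PosSemidef) (hr : E.map star = E) (v : n → ℂ) :
    ‖v ⬝ᵥ E *ᵥ v‖ ≤ (star v ⬝ᵥ E *ᵥ v).re := by
  obtain ⟨L, hL⟩ := exists_eq_conjTranspose_mul_self hE
  have h1 : ∀ u w : n → ℂ, star u ⬝ᵥ E *ᵥ w = star (L *ᵥ u) ⬝ᵥ L *ᵥ w := fun u w => by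
    rw [hL, ← mulVec_mulVec, star_mulVec, dotProduct_mulVec]
  have h2 : star (star v) ⬝ᵥ E *ᵥ star v = star (star v ⬝ᵥ E *ᵥ v) := by
    conv_lhs => rw [← hr]
    simp [dotProduct, mulVec]
  have h3 : v ⬝ᵥ E *ᵥ v = star (L *ᵥ star v) ⬝ᵥ L *ᵥ v := by rw [← h1, star_star]
  have h4 := norm_dotProduct_le (star (L *ᵥ star v)) (L *ᵥ v)
  rw [← h3, ← h1, star_star, dotProduct_comm (L *ᵥ star v), ← h1, h2] at h4
  simp only [RCLike.star_def, Complex.conj_re] at h4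
  linarith

section RealOperation

variable {n m κ : Type*} [Fintype n] [DecidableEq n] [Fintype m] [Fintype κ]
  {K : κ → Matrix m n ℂ}

theorem dotProduct_one_sub_sum_mulVec (K : κ → Matrix m n ℂ) (u v : n → ℂ) :
    u ⬝ᵥ (1 - ∑ k, (K k)ᴴ * K k) *ᵥ v = u ⬝ᵥ v - ∑ k, u ᵥ* (K k)ᴴ ⬝ᵥ K k *ᵥ v := by
  rw [sub_mulVec, one_mulVec, dotProduct_sub, sum_mulVec, dotProduct_sum]
  simp only [← mulVec_mulVec, dotProduct_mulVec]

theorem sum_normSq_mulVec_le (hle : ∑ k, (K k)ᴴ * K k ≤ 1) (v : n → ℂ) :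
    ∑ k, (star (K k *ᵥ v) ⬝ᵥ K k *ᵥ v).re ≤ (star v ⬝ᵥ v).re := by
  rw [Matrix.le_iff] at hle
  have h := (Complex.nonneg_iff.1 (hle.dotProduct_mulVec_nonneg v)).1
  rw [dotProduct_one_sub_sum_mulVec, Complex.sub_re, Complex.re_sum] at h
  simp only [← star_mulVec] at h
  linarith

/-- The defect `1 - ∑ Kᴴ K` is real and positive, so `norm_bilinear_le` applies to it. Reality also
gives `vᵀ Kᴴ = (K v)ᵀ`, which turns the expansion into bilinear squares of the output vectors. -/
theorem real_operation_bound (hK : ∀ k, IsRealMatrix (K k)) (hle : ∑ k, (K k)ᴴ * K k ≤ 1)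
    (v : n → ℂ) :
    ‖v ⬝ᵥ v‖ - (star v ⬝ᵥ v).re ≤
      ∑ k, (‖K k *ᵥ v ⬝ᵥ K k *ᵥ v‖ - (star (K k *ᵥ v) ⬝ᵥ K k *ᵥ v).re) := by
  rw [Matrix.le_iff] at hle
  have h := norm_bilinear_le hle (by
    ext i j
    simp only [map_apply, Matrix.sub_apply, Matrix.sum_apply, star_sub, star_sum, mul_apply]
    congr 1
    · simp only [one_apply]; split_ifs <;> simp
    refine Finset.sum_congr rfl fun k _ => Finset.sum_congr rfl fun l _ => ?_
    rw [star_mul', conjTranspose_apply]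
    congr 1
    · rw [star_star]; exact (Complex.conj_eq_iff_im.2 (hK k l i)).symm
    · exact Complex.conj_eq_iff_im.2 (hK k l j)) v
  rw [dotProduct_one_sub_sum_mulVec, dotProduct_one_sub_sum_mulVec] at h
  simp only [← star_mulVec] at h
  have h' : ∀ k, v ᵥ* (K k)ᴴ = K k *ᵥ v := fun k => by
    rw [(hK k).conjTranspose_eq, vecMul_transpose]
  simp only [h'] at h
  have h1 := norm_sub_norm_le (v ⬝ᵥ v) (∑ k, K k *ᵥ v ⬝ᵥ K k *ᵥ v)
  have h2 := norm_sum_le Finset.univ fun k => K k *ᵥ v ⬝ᵥ K k *ᵥ v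
  rw [Complex.sub_re, Complex.re_sum] at h
  rw [Finset.sum_sub_distrib]
  linarith

end RealOperation

/-! ### Steering and the upper bound -/

/-- The coefficient matrix of a bipartite vector, as an operator from Alice to Bob. -/
def coefficients {A B : Type*} (ψ : A × B → ℂ) : Matrix B A ℂ := Matrix.of fun b a => ψ (a, b)

theorem traceAlice_pureState {A B : Type*} [Fintype A] (ψ : A × B → ℂ) :
    traceAlice (pureState ψ) = coefficients ψ * (coefficients ψ)ᴴ := by
  ext b b'
  simp [traceAlice, pureState, coefficients, mul_apply, vecMulVec_apply]

theorem steeredState_pureState {A B : Type*} [Fintype A] [Fintype B] [DecidableEq B]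
    (M : Matrix A A ℂ) (ψ : A × B → ℂ) :
    steeredState M (pureState ψ) = coefficients ψ * Mᵀ * (coefficients ψ)ᴴ := by
  ext b b'
  simp only [steeredState, traceAlice, pureState, coefficients, of_apply, mul_apply,
    Fintype.sum_prod_type, kroneckerMap_apply, vecMulVec_apply, conjTranspose_apply,
    transpose_apply, one_apply, Finset.sum_mul, mul_ite, mul_one, mul_zero, ite_mul, zero_mul,
    Finset.sum_ite_eq, Finset.mem_univ, if_true, Pi.star_apply]
  refine Finset.sum_congr rfl fun a _ => Finset.sum_congr rfl fun a' _ => ?_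
  ring

theorem trace_traceAlice_pureState {A B : Type*} [Fintype A] [Fintype B]
    {ψ : A × B → ℂ} (hψ : ∑ x, ‖ψ x‖ ^ 2 = 1) :
    (traceAlice (pureState ψ)).trace = 1 := by
  have : (traceAlice (pureState ψ)).trace = ((∑ x, ‖ψ x‖ ^ 2 : ℝ) : ℂ) := by
    simp only [trace, diag, traceAlice, pureState, of_apply, vecMulVec_apply, Pi.star_apply,
      RCLike.star_def, Complex.mul_conj', Complex.ofReal_sum, Fintype.sum_prod_type]
    rw [Finset.sum_comm]
    norm_cast
  rw [this, hψ, Complex.ofReal_one]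

theorem trace_mul_conjTranspose_re {A B : Type*} [Fintype A] [Fintype B] (V : Matrix B A ℂ) :
    (V * Vᴴ).trace.re = ∑ a, (star (fun b => V b a) ⬝ᵥ fun b => V b a).re := by
  rw [trace_mul_comm, trace, Complex.re_sum]
  rfl

/-- Squeezes the total gap: the output ensemble has bilinear sum at most `p √F`, the steered
ensemble has at least `I_c`, and real operations compare the two. -/
theorem achievable_bound {A B B' : Type*} [Fintype A] [DecidableEq A] [Fintype B] [DecidableEq B]
    [Fintype B'] [DecidableEq B'] {ψ : A × B → ℂ} (hψ : ∑ x, ‖ψ x‖ ^ 2 = 1) {σ : Matrix B' B' ℂ}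
    (hσ : IsDensityMatrix σ) {p : ℝ} (hp : p ∈ achievableProbabilities ψ σ) :
    p ≤ 1 ∧ p * (1 - √(fidelity σ σᵀ)) ≤
      1 - concurrenceImaginarity (traceAlice (pureState ψ)) := by
  obtain ⟨P, hP⟩ := hp
  set W := coefficients ψ with hW
  have hρ : (traceAlice (pureState ψ)).PosSemidef := by
    rw [traceAlice_pureState]; exact posSemidef_self_mul_conjTranspose _
  have htr := trace_traceAlice_pureState hψ
  obtain ⟨Yρ, dρ, hdρ, hYρ, hYρ', -, hI⟩ := exists_bilinear_orthogonal_decomposition hρ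
  obtain ⟨Y, d, hd, hY, hY', hf, -⟩ := exists_bilinear_orthogonal_decomposition hσ.1
  choose L hL using fun j => exists_eq_conjTranspose_mul_self (P.povm_posSemidef j)
  have hLt : ∀ j, (P.povm j)ᵀ = (L j)ᵀ * (L j)ᵀᴴ := fun j => by
    conv_lhs => rw [hL j]
    rw [transpose_mul]; rfl
  -- Factoring each POVM element refines Alice's measurement to rank one; the columns are Bob's
  -- resulting unnormalised pure states.
  let V : Matrix B (Fin P.outcomes × A) ℂ := Matrix.of fun b x => (W * (L x.1)ᵀ) b x.2
  have hV : V * Vᴴ = Yρ * Yρᴴ := by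
    have h1 : V * Vᴴ = ∑ j, W * (L j)ᵀ * (W * (L j)ᵀ)ᴴ := by
      ext b b'
      rw [mul_apply, Fintype.sum_prod_type, Matrix.sum_apply]
      rfl
    have h2 : ∀ j, W * (L j)ᵀ * (W * (L j)ᵀ)ᴴ = W * (P.povm j)ᵀ * Wᴴ := fun j => by
      rw [hLt, conjTranspose_mul]; simp only [Matrix.mul_assoc]
    simp only [h1, h2]
    rw [← Matrix.sum_mul, ← Matrix.mul_sum, ← transpose_sum, P.povm_sum, transpose_one,
      Matrix.mul_one, hYρ, traceAlice_pureState]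
  let V' : Matrix B' ((j : Fin P.outcomes) × (Fin (P.krausRank j) × A)) ℂ :=
    Matrix.of fun b x => (P.kraus x.1 x.2.1 *ᵥ fun b => V b (x.1, x.2.2)) b
  have hV' : V' * V'ᴴ = (p : ℂ) • σ := by
    rw [← hP]
    have h2 : ∀ j k, P.kraus j k * steeredState (P.povm j) (pureState ψ) * (P.kraus j k)ᴴ =
        P.kraus j k * (W * (L j)ᵀ) * (P.kraus j k * (W * (L j)ᵀ))ᴴ := fun j k => by
      rw [steeredState_pureState, hLt, conjTranspose_mul, conjTranspose_mul]
      simp only [Matrix.mul_assoc, ← hW]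
    rw [AssistedProtocol.output]
    simp only [h2]
    ext b b'
    rw [mul_apply, Fintype.sum_sigma, Matrix.sum_apply]
    refine Finset.sum_congr rfl fun j _ => ?_
    rw [Fintype.sum_prod_type, Matrix.sum_apply]
    rfl
  have hptr : p = (V' * V'ᴴ).trace.re := by
    rw [hV', trace_smul, hσ.2]; simp
  have hp0 : 0 ≤ p := by
    rw [hptr]
    exact (Complex.nonneg_iff.1 (posSemidef_self_mul_conjTranspose V').trace_nonneg).1
  have hout : ∑ x, ‖(V'ᵀ * V') x x‖ ≤ p * √(fidelity σ σᵀ) := by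
    have hs : ((√p : ℝ) : ℂ) * (√p : ℝ) = p := by
      rw [← Complex.ofReal_mul, Real.mul_self_sqrt hp0]
    -- `√p Y` is a bilinear-orthogonal decomposition of `p σ`, with weights `p d`.
    have := sum_norm_bilinear_le (Y := ((√p : ℝ) : ℂ) • Y) (V := V') (d := fun i => p * d i)
      (fun i => mul_nonneg hp0 (hd i)) (by
        rw [transpose_smul, Matrix.smul_mul, Matrix.mul_smul, smul_smul, hs, hY', ← diagonal_smul]
        congr 1; ext i; simp) (by
        rw [hV', conjTranspose_smul, Matrix.smul_mul, Matrix.mul_smul, smul_smul, RCLike.star_def,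
          Complex.conj_ofReal, hs, hY])
    rwa [← Finset.mul_sum, ← hf] at this
  have hin : concurrenceImaginarity (traceAlice (pureState ψ)) ≤ ∑ x, ‖(Vᵀ * V) x x‖ := by
    have : Nonempty B := by
      by_contra hB
      rw [not_nonempty_iff] at hB
      simp at hψ
    obtain ⟨i₀, -, hI⟩ := hI this
    rw [hI]
    exact max_le (Finset.sum_nonneg fun _ _ => norm_nonneg _)
      (le_sum_norm_bilinear hdρ hYρ' hV i₀)
  have htrV : ∑ x, (star (fun b => V b x) ⬝ᵥ fun b => V b x).re = 1 := by
    rw [← trace_mul_conjTranspose_re, hV, hYρ, htr, Complex.one_re]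
  have htrV' : ∑ x, (star (fun b => V' b x) ⬝ᵥ fun b => V' b x).re = p := by
    rw [← trace_mul_conjTranspose_re, ← hptr]
  have hle : ∑ x, (‖(Vᵀ * V) x x‖ - (star (fun b => V b x) ⬝ᵥ fun b => V b x).re) ≤
      ∑ x, (‖(V'ᵀ * V') x x‖ - (star (fun b => V' b x) ⬝ᵥ fun b => V' b x).re) := by
    rw [Fintype.sum_prod_type, Fintype.sum_sigma]
    refine Finset.sum_le_sum fun j _ => ?_
    rw [Fintype.sum_prod_type, Finset.sum_comm]
    refine Finset.sum_le_sum fun a _ => ?_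
    exact real_operation_bound (P.kraus_real j) (P.kraus_sum_le j) fun b => V b (j, a)
  have hpos : ∑ x, (star (fun b => V' b x) ⬝ᵥ fun b => V' b x).re ≤
      ∑ x, (star (fun b => V b x) ⬝ᵥ fun b => V b x).re := by
    rw [Fintype.sum_prod_type, Fintype.sum_sigma]
    refine Finset.sum_le_sum fun j _ => ?_
    rw [Fintype.sum_prod_type, Finset.sum_comm]
    refine Finset.sum_le_sum fun a _ => ?_
    exact sum_normSq_mulVec_le (P.kraus_sum_le j) fun b => V b (j, a)
  rw [Finset.sum_sub_distrib, Finset.sum_sub_distrib, htrV, htrV'] at hle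
  refine ⟨?_, ?_⟩
  · rwa [htrV, htrV'] at hpos
  · linarith

/-! ### Tight frames and equally imaginary ensembles -/

/-- The normalised vectors of signs form a tight frame. -/
noncomputable def signFrame (m : Type*) [Fintype m] : Matrix m (m → Bool) ℝ :=
  Matrix.of fun i ε => (√(2 ^ Fintype.card m))⁻¹ * if ε i then 1 else -1

/-- Off the diagonal, flipping the sign at `i` is an involution that negates each summand, so the
sum equals its own negative. -/
theorem signFrame_mul_transpose (m : Type*) [Fintype m] [DecidableEq m] :
    signFrame m * (signFrame m)ᵀ = 1 := by
  have hs : (√(2 ^ Fintype.card m : ℝ))⁻¹ * (√(2 ^ Fintype.card m : ℝ))⁻¹ =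
      ((2 : ℝ) ^ Fintype.card m)⁻¹ := by
    rw [← mul_inv, Real.mul_self_sqrt (by positivity)]
  ext i j
  rw [mul_apply]
  simp only [signFrame, of_apply, transpose_apply]
  by_cases hij : i = j
  · subst hij
    have : ∀ ε : m → Bool, (√(2 ^ Fintype.card m))⁻¹ * (if ε i then (1 : ℝ) else -1) *
        ((√(2 ^ Fintype.card m))⁻¹ * if ε i then 1 else -1) = ((2 : ℝ) ^ Fintype.card m)⁻¹ :=
      fun ε => by rw [← hs]; cases ε i <;> simp
    simp only [this]
    simp
  · rw [one_apply_ne hij]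
    have hinv : Function.Involutive fun ε : m → Bool => Function.update ε i (!ε i) := fun ε => by
      simp
    set τ := Function.Involutive.toPerm _ hinv with hτ
    have h := Equiv.sum_comp τ fun ε : m → Bool =>
      (√(2 ^ Fintype.card m))⁻¹ * (if ε i then (1 : ℝ) else -1) *
        ((√(2 ^ Fintype.card m))⁻¹ * if ε j then 1 else -1)
    have h2 : ∀ ε : m → Bool, (√(2 ^ Fintype.card m))⁻¹ *
        (if τ ε i then (1 : ℝ) else -1) *
        ((√(2 ^ Fintype.card m))⁻¹ * if τ ε j then 1 else -1) =
        -((√(2 ^ Fintype.card m))⁻¹ * (if ε i then (1 : ℝ) else -1) *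
        ((√(2 ^ Fintype.card m))⁻¹ * if ε j then 1 else -1)) := fun ε => by
      rw [hτ, Function.Involutive.coe_toPerm, Function.update_self,
        Function.update_of_ne (Ne.symm hij)]
      cases ε i <;> cases ε j <;> simp
    simp only [h2, Finset.sum_neg_distrib] at h
    linarith

/-- All frame entries have the same square, so every frame vector sees only the trace of a diagonal
form. -/
theorem sum_mul_signFrame_sq {m : Type*} [Fintype m] {δ : m → ℂ} (hδ : ∑ i, δ i = 0)
    (ε : m → Bool) : ∑ i, δ i * (signFrame m i ε : ℂ) ^ 2 = 0 := by
  have : ∀ i, (signFrame m i ε : ℂ) ^ 2 = ((√(2 ^ Fintype.card m) : ℝ) : ℂ)⁻¹ ^ 2 := fun i => by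
    simp only [signFrame, of_apply]
    cases ε i <;> simp
  simp only [this]
  rw [← Finset.sum_mul, hδ, zero_mul]

/-- A real symmetric traceless matrix has zero diagonal in some tight frame. -/
theorem exists_frame_diag_eq_zero {m : Type*} [Fintype m] [DecidableEq m] {H : Matrix m m ℝ}
    (hH : Hᵀ = H) (htr : H.trace = 0) :
    ∃ F : Matrix m (m → Bool) ℝ, F * Fᵀ = 1 ∧ ∀ j, (Fᵀ * H * F) j j = 0 := by
  have hH' : H.IsHermitian := by
    rw [IsHermitian, conjTranspose_eq_transpose_of_trivial, hH]
  obtain ⟨O, e, hO, hO', h⟩ : ∃ (O : Matrix m m ℝ) (e : m → ℝ), Oᵀ * O = 1 ∧ O * Oᵀ = 1 ∧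
      H = O * diagonal e * Oᵀ := by
    refine ⟨hH'.eigenvectorUnitary, hH'.eigenvalues,
      Unitary.coe_star_mul_self hH'.eigenvectorUnitary,
      Unitary.coe_mul_star_self hH'.eigenvectorUnitary, ?_⟩
    conv_lhs => rw [hH'.spectral_theorem]
    rw [Unitary.conjStarAlgAut_apply]
    rfl
  refine ⟨O * signFrame m, ?_, fun j => ?_⟩
  · rw [transpose_mul, Matrix.mul_assoc, ← Matrix.mul_assoc (signFrame m),
      signFrame_mul_transpose, Matrix.one_mul, hO']
  · have h1 : (O * signFrame m)ᵀ * H * (O * signFrame m) =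
        (signFrame m)ᵀ * (diagonal e * signFrame m) := by
      rw [h, transpose_mul]
      calc _ = (signFrame m)ᵀ * ((Oᵀ * O) * diagonal e * (Oᵀ * O) * signFrame m) := by
            simp only [Matrix.mul_assoc]
        _ = _ := by rw [hO, Matrix.one_mul, Matrix.mul_one]
    have h2 : ∑ i, (e i : ℂ) = 0 := by
      rw [h, trace_mul_comm, ← Matrix.mul_assoc, hO, Matrix.one_mul, trace_diagonal] at htr
      exact_mod_cast htr
    have h3 : ∑ i, e i * signFrame m i j ^ 2 = 0 := by
      exact_mod_cast sum_mul_signFrame_sq h2 j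
    rw [h1, mul_apply, ← h3]
    simp only [diagonal_mul, transpose_apply]
    exact Finset.sum_congr rfl fun i _ => by ring

/-- Greedy choice: giving each new term the sign opposite to the running sum keeps that sum in `[-M,
M]`. -/
theorem exists_signs {m : Type*} [DecidableEq m] {d : m → ℝ} {M : ℝ} (hd : ∀ i, 0 ≤ d i)
    (hM : ∀ i, d i ≤ M) (hM0 : 0 ≤ M) (S : Finset m) :
    ∃ s : m → Bool, |∑ i ∈ S, (if s i then 1 else -1) * d i| ≤ M := by
  induction S using Finset.induction_on with
  | empty => exact ⟨fun _ => true, by simpa using hM0⟩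
  | insert a S ha ih =>
    obtain ⟨s, hs⟩ := ih
    rw [abs_le] at hs
    have key : ∀ c : Bool, ∑ i ∈ insert a S, (if Function.update s a c i then (1 : ℝ) else -1) * d i =
        (if c then 1 else -1) * d a + ∑ i ∈ S, (if s i then 1 else -1) * d i := fun c => by
      rw [Finset.sum_insert ha, Function.update_self]
      congr 1
      refine Finset.sum_congr rfl fun i hi => ?_
      rw [Function.update_of_ne (ne_of_mem_of_not_mem hi ha)]
    have := hd a
    have := hM a
    rcases le_total 0 (∑ i ∈ S, (if s i then (1 : ℝ) else -1) * d i) with h | h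
    · refine ⟨Function.update s a false, ?_⟩
      rw [key, abs_le]
      constructor <;> simp only [Bool.false_eq_true, if_false] <;> linarith
    · refine ⟨Function.update s a true, ?_⟩
      rw [key, abs_le]
      constructor <;> simp only [if_true] <;> linarith

/-- Lengths satisfying the polygon inequality are the sides of a closed polygon. -/
theorem exists_closed_polygon {m : Type*} [Fintype m] [DecidableEq m] {d : m → ℝ}
    (hd : ∀ i, 0 ≤ d i) {i₀ : m} (hi₀ : ∀ i, d i ≤ d i₀) (h : 2 * d i₀ ≤ ∑ i, d i) :
    ∃ ζ : m → ℂ, (∀ i, ‖ζ i‖ = 1) ∧ ∑ i, (d i : ℂ) * ζ i = 0 := by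
  rcases (hd i₀).eq_or_lt with h0 | h0
  · refine ⟨fun _ => 1, fun _ => norm_one, Finset.sum_eq_zero fun i _ => ?_⟩
    rw [le_antisymm ((hi₀ i).trans h0.ge) (hd i)]; simp
  obtain ⟨s, hs⟩ := exists_signs hd hi₀ (hd i₀) (Finset.univ.erase i₀)
  -- Sides with `s i` true stay fixed and the others turn by `θ`. The resultant is at least `d i₀`
  -- at `θ = 0` and at most `d i₀` at `θ = π`; where it equals `d i₀`, the side `i₀` closes the
  -- polygon.
  let z : ℝ → m → ℂ := fun θ i => if s i then 1 else Complex.exp (θ * Complex.I)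
  have hz : ∀ θ i, ‖z θ i‖ = 1 := fun θ i => by
    simp only [z]; split_ifs
    · exact norm_one
    · exact Complex.norm_exp_ofReal_mul_I θ
  let g : ℝ → ℝ := fun θ => ‖∑ i ∈ Finset.univ.erase i₀, (d i : ℂ) * z θ i‖
  have hg : Continuous g := by
    refine (continuous_finsetSum _ fun i _ => continuous_const.mul ?_).norm
    simp only [z]
    split_ifs <;> fun_prop
  have hg0 : d i₀ ≤ g 0 := by
    have : ∑ i ∈ Finset.univ.erase i₀, (d i : ℂ) * z 0 i =
        ((∑ i ∈ Finset.univ.erase i₀, d i : ℝ) : ℂ) := by simp [z]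
    simp only [g, this, Complex.norm_real, Real.norm_eq_abs]
    rw [← Finset.add_sum_erase _ _ (Finset.mem_univ i₀)] at h
    exact le_trans (by linarith) (le_abs_self _)
  have hgπ : g Real.pi ≤ d i₀ := by
    have : ∑ i ∈ Finset.univ.erase i₀, (d i : ℂ) * z Real.pi i =
        ((∑ i ∈ Finset.univ.erase i₀, (if s i then 1 else -1) * d i : ℝ) : ℂ) := by
      rw [Complex.ofReal_sum]
      refine Finset.sum_congr rfl fun i _ => ?_
      cases hsi : s i <;> simp [z, hsi]
    simpa only [g, this, Complex.norm_real, Real.norm_eq_abs] using hs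
  obtain ⟨θ, -, hθ⟩ := intermediate_value_Icc' Real.pi_pos.le hg.continuousOn ⟨hgπ, hg0⟩
  set w := ∑ i ∈ Finset.univ.erase i₀, (d i : ℂ) * z θ i with hw
  have hwn : ‖w‖ = d i₀ := hθ
  refine ⟨Function.update (z θ) i₀ (-w / d i₀), fun i => ?_, ?_⟩
  · by_cases hi : i = i₀
    · subst hi
      rw [Function.update_self, norm_div, norm_neg, hwn, Complex.norm_real, Real.norm_eq_abs,
        abs_of_pos h0, div_self h0.ne']
    · rw [Function.update_of_ne hi, hz]
  · have hne : (d i₀ : ℂ) ≠ 0 := by exact_mod_cast h0.ne'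
    rw [← Finset.add_sum_erase _ _ (Finset.mem_univ i₀), Function.update_self, mul_div_cancel₀ _ hne]
    have : ∑ i ∈ Finset.univ.erase i₀, (d i : ℂ) * Function.update (z θ) i₀ (-w / d i₀) i = w :=
      Finset.sum_congr rfl fun i hi => by rw [Function.update_of_ne (Finset.ne_of_mem_erase hi)]
    rw [this]; ring

theorem rephase_frame {n m l : Type*} [Fintype m] [DecidableEq m] [Fintype l]
    (Y : Matrix n m ℂ) {η : m → ℂ} (hη : ∀ i, ‖η i‖ = 1) {F : Matrix m l ℝ} (hF : F * Fᵀ = 1) :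
    Y * diagonal η * F.map Complex.ofReal * (Y * diagonal η * F.map Complex.ofReal)ᴴ = Y * Yᴴ := by
  have h1 : F.map Complex.ofReal * (F.map Complex.ofReal)ᴴ = 1 := by
    have := congrArg (fun M => M.map Complex.ofRealHom) hF
    simp only [Matrix.map_mul, Matrix.map_one _ (map_zero _) (map_one _)] at this
    rw [← this]
    congr 1
    ext i j
    simp
  have h2 : diagonal η * (diagonal η)ᴴ = 1 := by
    rw [diagonal_conjTranspose, diagonal_mul_diagonal, ← diagonal_one]
    congr 1; ext i
    simp [Complex.mul_conj', hη]
  calc _ = Y * (diagonal η * (F.map Complex.ofReal * (F.map Complex.ofReal)ᴴ) * (diagonal η)ᴴ)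
        * Yᴴ := by simp only [conjTranspose_mul, Matrix.mul_assoc]
    _ = _ := by rw [h1, Matrix.mul_one, h2, Matrix.mul_one]

/-- An optimal decomposition, all of whose vectors are equally imaginary. -/
theorem exists_equalized_decomposition {n m : Type*} [Fintype n] [Fintype m] [DecidableEq m]
    {Y : Matrix n m ℂ} {d : m → ℝ} (hd : ∀ i, 0 ≤ d i)
    (hY : Yᵀ * Y = diagonal (fun i => (d i : ℂ))) (htr : (Y * Yᴴ).trace = 1) {i₀ : m}
    (hi₀ : ∀ i, d i ≤ d i₀) :
    ∃ V : Matrix n (m → Bool) ℂ, V * Vᴴ = Y * Yᴴ ∧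
      ∀ j, (Vᵀ * V) j j = (max 0 (2 * d i₀ - ∑ i, d i) : ℝ) * (Vᴴ * V) j j := by
  have hbil : ∀ (η : m → ℂ) (F : Matrix m (m → Bool) ℝ),
      (Y * diagonal η * F.map Complex.ofReal)ᵀ * (Y * diagonal η * F.map Complex.ofReal) =
        (F.map Complex.ofReal)ᵀ * diagonal (fun i => (d i : ℂ) * η i ^ 2) * F.map Complex.ofReal :=
    fun η F => by
    calc _ = (F.map Complex.ofReal)ᵀ * (diagonal η * (Yᵀ * Y) * diagonal η) *
          F.map Complex.ofReal := by
          simp only [transpose_mul, diagonal_transpose, Matrix.mul_assoc]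
      _ = _ := by
          rw [hY, diagonal_mul_diagonal, diagonal_mul_diagonal]
          congr 3; ext i; ring
  rcases le_or_gt (2 * d i₀) (∑ i, d i) with h | h
  · obtain ⟨ζ, hζ, hsum⟩ := exists_closed_polygon hd hi₀ h
    -- Rephasing a column by `η` multiplies its bilinear square by `η²`, hence the square roots.
    choose η hη using fun i => IsAlgClosed.exists_pow_nat_eq (ζ i) two_pos
    have hη1 : ∀ i, ‖η i‖ = 1 := fun i => by
      have := hζ i
      rw [← hη, norm_pow] at this
      exact (pow_eq_one_iff_of_nonneg (norm_nonneg _) two_ne_zero).1 this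
    refine ⟨_, rephase_frame Y hη1 (signFrame_mul_transpose m), fun j => ?_⟩
    rw [max_eq_left (by linarith), hbil, Complex.ofReal_zero, zero_mul, Matrix.mul_assoc, mul_apply]
    simp only [diagonal_mul, hη]
    rw [← sum_mul_signFrame_sq hsum j]
    refine Finset.sum_congr rfl fun i _ => ?_
    simp only [transpose_apply, map_apply]
    ring
  · rw [max_eq_right (by linarith)]
    set c := 2 * d i₀ - ∑ i, d i with hc
    -- The phase `i` negates every weight except the dominant one, so the new weights sum to `c`.
    let η : m → ℂ := fun i => if i = i₀ then 1 else Complex.I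
    let δ : m → ℝ := fun i => if i = i₀ then d i else -d i
    have hη1 : ∀ i, ‖η i‖ = 1 := fun i => by simp only [η]; split_ifs <;> simp
    have hδ : ∀ i, (d i : ℂ) * η i ^ 2 = δ i := fun i => by
      simp only [η, δ]; split_ifs <;> simp
    set Z := Y * diagonal η with hZ
    have hZZ : Z * Zᴴ = Y * Yᴴ := by
      have := rephase_frame Y hη1 (F := (1 : Matrix m m ℝ)) (by simp)
      rwa [Matrix.map_one _ Complex.ofReal_zero Complex.ofReal_one, Matrix.mul_one, ← hZ] at this
    -- Only the real part of the Gram matrix matters, because the frame is real and only diagonal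
    -- entries are compared.
    set G : Matrix m m ℝ := (Zᴴ * Z).map Complex.re with hG
    have hGt : Gᵀ = G := by
      ext i j
      have := congrFun (congrFun (isHermitian_conjTranspose_mul_self Z) j) i
      rw [conjTranspose_apply] at this
      simp only [hG, transpose_apply, map_apply]
      rw [← this]; simp
    have hGtr : G.trace = 1 := by
      have : G.trace = (Zᴴ * Z).trace.re := by
        simp only [trace, Complex.re_sum, hG]; rfl
      rw [this, trace_mul_comm, hZZ, htr, Complex.one_re]
    -- `G` has trace one, so subtracting `c G` removes the trace; a zero diagonal in the frame says
    -- that every vector has bilinear square `c` times its squared norm.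
    obtain ⟨F, hF, hF0⟩ := exists_frame_diag_eq_zero (H := diagonal δ - c • G)
      (by rw [transpose_sub, transpose_smul, diagonal_transpose, hGt])
      (by
        rw [trace_sub, trace_smul, hGtr, trace_diagonal, ← Finset.add_sum_erase _ _
          (Finset.mem_univ i₀), hc, ← Finset.add_sum_erase _ d (Finset.mem_univ i₀)]
        have : ∑ i ∈ Finset.univ.erase i₀, δ i = -∑ i ∈ Finset.univ.erase i₀, d i := by
          rw [← Finset.sum_neg_distrib]
          exact Finset.sum_congr rfl fun i hi => if_neg (Finset.ne_of_mem_erase hi)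
        rw [this]
        simp [δ]; ring)
    refine ⟨_, rephase_frame Y hη1 hF, fun j => ?_⟩
    rw [hbil, ← hZ]
    set Fc := F.map Complex.ofReal
    have h1 : (Fcᵀ * diagonal (fun i => (d i : ℂ) * η i ^ 2) * Fc) j j =
        ((Fᵀ * diagonal δ * F) j j : ℝ) := by
      simp only [hδ, mul_apply, Fc]
      simp [diagonal_apply]
    have h2 : ((Z * Fc)ᴴ * (Z * Fc)) j j = ((Fᵀ * G * F) j j : ℝ) := by
      have him : (((Z * Fc)ᴴ * (Z * Fc)) j j).im = 0 := by
        have := (posSemidef_conjTranspose_mul_self (Z * Fc)).diag_nonneg (i := j)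
        exact (Complex.nonneg_iff.1 this).2.symm
      refine Complex.ext ?_ (by rw [him, Complex.ofReal_im])
      have : (Z * Fc)ᴴ * (Z * Fc) = Fcᴴ * (Zᴴ * Z) * Fc := by
        simp only [conjTranspose_mul, Matrix.mul_assoc]
      rw [this, Complex.ofReal_re, mul_apply, mul_apply, Complex.re_sum]
      refine Finset.sum_congr rfl fun i _ => ?_
      rw [mul_apply, mul_apply]
      simp only [Fc, hG, map_apply, conjTranspose_apply, transpose_apply, RCLike.star_def,
        Complex.conj_ofReal, Complex.re_mul_ofReal, Complex.re_sum, Complex.re_ofReal_mul]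
    rw [h1, h2, ← Complex.ofReal_mul]
    have := hF0 j
    rw [Matrix.mul_sub, Matrix.sub_mul, Matrix.mul_smul, Matrix.smul_mul, Matrix.sub_apply,
      Matrix.smul_apply, smul_eq_mul, sub_eq_zero] at this
    rw [this]

/-! ### Construction of protocols -/

theorem exists_protocol {A B B' ι κ : Type*} [Fintype A] [DecidableEq A] [Fintype B]
    [DecidableEq B] [Fintype B'] [Fintype ι] [Fintype κ] (M : ι → Matrix A A ℂ)
    (hM : ∀ i, (M i).PosSemidef) (hsum : ∑ i, M i = 1) (K : ι → κ → Matrix B' B ℂ)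
    (hK : ∀ i k, IsRealMatrix (K i k)) (hle : ∀ i, ∑ k, (K i k)ᴴ * K i k ≤ 1) :
    ∃ P : AssistedProtocol A B B', ∀ ρ,
      P.output ρ = ∑ i, ∑ k, K i k * steeredState (M i) ρ * (K i k)ᴴ := by
  let e := (Fintype.equivFin ι).symm
  let e' := (Fintype.equivFin κ).symm
  refine ⟨{ outcomes := Fintype.card ι
            povm := fun j => M (e j)
            povm_posSemidef := fun j => hM _
            povm_sum := by rw [Equiv.sum_comp e M, hsum]
            krausRank := fun _ => Fintype.card κ
            kraus := fun j k => K (e j) (e' k)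
            kraus_real := fun j k => hK _ _
            kraus_sum_le := fun j => by
              rw [Equiv.sum_comp e' fun k => (K (e j) k)ᴴ * K (e j) k]
              exact hle _ }, fun ρ => ?_⟩
  rw [AssistedProtocol.output,
    ← Equiv.sum_comp e fun i => ∑ k, K i k * steeredState (M i) ρ * (K i k)ᴴ]
  refine Finset.sum_congr rfl fun j _ => ?_
  exact Equiv.sum_comp e' fun k => K (e j) k * steeredState (M (e j)) ρ * (K (e j) k)ᴴ

theorem zero_mem_achievable {A B B' : Type*} [Fintype A] [DecidableEq A] [Fintype B]
    [DecidableEq B] [Fintype B'] (ψ : A × B → ℂ) (σ : Matrix B' B' ℂ) :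
    0 ∈ achievableProbabilities ψ σ := by
  obtain ⟨P, hP⟩ := exists_protocol (A := A) (B := B) (B' := B') (ι := Unit) (κ := Empty)
    (fun _ => 1) (fun _ => PosSemidef.one) (by simp) (fun _ k => k.elim) (fun _ k => k.elim)
    (fun _ => by simp)
  exact ⟨P, by simp [hP]⟩

/-- The square root commutes with transposition, so that of a real state is symmetric as well as
Hermitian. -/
theorem isRealMatrix_sqrt {n : Type*} [Fintype n] [DecidableEq n] {σ : Matrix n n ℂ}
    (hσ : σ.PosSemidef) (hr : IsRealMatrix σ) : IsRealMatrix (CFC.sqrt σ) := by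
  have h1 : (CFC.sqrt σ)ᵀ = CFC.sqrt σ := by
    rw [← sqrt_transpose hσ, ← hr.conjTranspose_eq, hσ.isHermitian.eq]
  have h2 : (CFC.sqrt σ)ᴴ = CFC.sqrt σ :=
    (Matrix.nonneg_iff_posSemidef.mp (CFC.sqrt_nonneg σ)).isHermitian
  intro i j
  have := congrFun (congrFun (h2.trans h1.symm) j) i
  exact Complex.conj_eq_iff_im.1 this

/-- A real state can be prepared after discarding the input. -/
theorem one_mem_achievable_of_real {A B B' : Type*} [Fintype A] [DecidableEq A] [Fintype B]
    [DecidableEq B] [Fintype B'] [DecidableEq B'] {ψ : A × B → ℂ} (hψ : ∑ x, ‖ψ x‖ ^ 2 = 1)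
    {σ : Matrix B' B' ℂ} (hσ : IsDensityMatrix σ) (hr : IsRealMatrix σ) :
    1 ∈ achievableProbabilities ψ σ := by
  set X := CFC.sqrt σ
  have hX : IsRealMatrix X := isRealMatrix_sqrt hσ.1 hr
  have hXh : Xᴴ = X := (Matrix.nonneg_iff_posSemidef.mp (CFC.sqrt_nonneg σ)).isHermitian
  have hXX : X * Xᴴ = σ := by
    rw [hXh]; exact CFC.sqrt_mul_sqrt_self σ (Matrix.nonneg_iff_posSemidef.mpr hσ.1)
  -- Measure and prepare: Bob reads out `b` in the reference basis and prepares a column of `√σ`.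
  let K : B' × B → Matrix B' B ℂ := fun x => Matrix.of fun i b => if b = x.2 then X i x.1 else 0
  obtain ⟨P, hP⟩ := exists_protocol (A := A) (B := B) (ι := Unit) (fun _ => 1)
    (fun _ => PosSemidef.one) (by simp) (fun _ => K)
    (fun _ x i b => by
      simp only [K, of_apply]
      split_ifs
      · exact hX _ _
      · rfl)
    (fun _ => by
      refine le_of_eq ?_
      have htr := hσ.2
      rw [← hXX, trace_mul_comm, trace] at htr
      ext b c
      rw [Matrix.sum_apply, Fintype.sum_prod_type]
      by_cases hbc : b = c
      · subst hbc
        rw [one_apply_eq, ← htr]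
        refine Finset.sum_congr rfl fun l _ => ?_
        simp [K, mul_apply, apply_ite]
      · rw [one_apply_ne hbc]
        refine Finset.sum_eq_zero fun l _ => Finset.sum_eq_zero fun a _ => ?_
        rw [mul_apply]
        refine Finset.sum_eq_zero fun i _ => ?_
        simp only [K, conjTranspose_apply, of_apply]
        by_cases hb : b = a
        · rw [if_neg (fun h : c = a => hbc (hb.trans h.symm)), mul_zero]
        · rw [if_neg hb, star_zero, zero_mul])
  refine ⟨P, ?_⟩
  have hst : steeredState (1 : Matrix A A ℂ) (pureState ψ) = traceAlice (pureState ψ) := by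
    rw [steeredState, one_kronecker_one, Matrix.one_mul]
  rw [hP, Finset.univ_unique, Finset.sum_singleton, hst, Complex.ofReal_one, one_smul]
  set ρ := traceAlice (pureState ψ)
  have hterm : ∀ l b i i', (K (l, b) * ρ * (K (l, b))ᴴ) i i' = X i l * ρ b b * star (X i' l) := by
    intro l b i i'
    simp [K, mul_apply, apply_ite]
  ext i i'
  rw [Matrix.sum_apply, Fintype.sum_prod_type, ← hXX, mul_apply]
  refine Finset.sum_congr rfl fun l _ => ?_
  simp only [hterm]
  rw [← Finset.sum_mul, ← Finset.mul_sum]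
  have : ∑ b, ρ b b = 1 := trace_traceAlice_pureState hψ
  rw [this, mul_one, conjTranspose_apply]

/-- A POVM element reaches Bob's state through its transpose, so the transposed projector onto a
column of `C` steers Bob to the matching column of `V`. -/
theorem steered_column {A B ι : Type*} [Fintype A] [Fintype B] [DecidableEq B]
    (ψ : A × B → ℂ) {V : Matrix B ι ℂ} {C : Matrix A ι ℂ} (h : V = coefficients ψ * C) (i : ι) :
    steeredState (vecMulVec (fun a => C a i) (star fun a => C a i))ᵀ (pureState ψ) =
      vecMulVec (fun b => V b i) (star fun b => V b i) := by
  have hv : (fun b => V b i) = coefficients ψ *ᵥ fun a => C a i := by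
    subst h; rfl
  rw [steeredState_pureState, transpose_transpose, mul_vecMulVec, vecMulVec_mul, hv, star_mulVec]

/-- Alice can steer Bob into any decomposition of his state. -/
theorem mem_achievable_of_decomposition {A B B' ι κ : Type*} [Fintype A] [DecidableEq A]
    [Fintype B] [DecidableEq B] [Fintype B'] [Fintype ι] [Fintype κ] {ψ : A × B → ℂ}
    (hψ : ∑ x, ‖ψ x‖ ^ 2 = 1) {σ : Matrix B' B' ℂ} {p : ℝ} {V : Matrix B ι ℂ}
    (hV : V * Vᴴ = traceAlice (pureState ψ)) (K : ι → κ → Matrix B' B ℂ)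
    (hK : ∀ i k, IsRealMatrix (K i k)) (hle : ∀ i, ∑ k, (K i k)ᴴ * K i k ≤ 1)
    (hout : ∀ i, ∑ k, K i k * vecMulVec (fun b => V b i) (star fun b => V b i) * (K i k)ᴴ =
      ((p : ℂ) * (Vᴴ * V) i i) • σ) :
    p ∈ achievableProbabilities ψ σ := by
  obtain ⟨C, hC, hC1, hC2⟩ := exists_contraction (hV.trans (traceAlice_pureState ψ))
  obtain ⟨P, hP⟩ := exists_protocol (A := A) (B := B) (ι := Option ι)
    -- The extra outcome `none` completes the POVM; Bob answers it with the zero operation.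
    (fun i => i.elim (1 - C * Cᴴ)ᵀ fun i => (vecMulVec (fun a => C a i) (star fun a => C a i))ᵀ)
    (fun i => by
      cases i with
      | none => exact (Matrix.le_iff.1 hC2).transpose
      | some i => exact (posSemidef_vecMulVec_self_star _).transpose)
    (by
      rw [Fintype.sum_option]
      simp only [Option.elim]
      rw [← transpose_sum, ← transpose_add, ← transpose_one]
      congr 1
      rw [sub_add_eq_add_sub, sub_eq_iff_eq_add, transpose_one]
      congr 1
      ext a b
      rw [Matrix.sum_apply, mul_apply]
      rfl)
    (fun i k => i.elim 0 fun i => K i k)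
    (fun i k => by
      cases i with
      | none => exact fun _ _ => rfl
      | some i => exact hK i k)
    (fun i => by
      cases i with
      | none => simp
      | some i => exact hle i)
  refine ⟨P, ?_⟩
  rw [hP, Fintype.sum_option]
  simp only [Option.elim, Matrix.zero_mul, Finset.sum_const_zero, zero_add, steered_column ψ hC,
    hout]
  rw [← Finset.sum_smul, ← Finset.mul_sum]
  have : ∑ i, (Vᴴ * V) i i = 1 := by
    rw [← trace_traceAlice_pureState hψ, ← hV, trace_mul_comm]; rfl
  rw [this, mul_one]

/-! ### Real and imaginary parts of a bilinear-orthogonal decomposition -/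

section RealParts

variable {n m : Type*} [Fintype n] {Y : Matrix n m ℂ} {d : m → ℝ}

theorem sum_sq_sub_sq [DecidableEq m] (hY : Yᵀ * Y = diagonal (fun i => (d i : ℂ))) (l : m) :
    ∑ i, ((Y i l).re ^ 2 - (Y i l).im ^ 2) = d l := by
  have := congrArg Complex.re (congrFun (congrFun hY l) l)
  rw [mul_apply, diagonal_apply_eq, Complex.ofReal_re, Complex.re_sum] at this
  rw [← this]
  exact Finset.sum_congr rfl fun i _ => by
    rw [transpose_apply, Complex.mul_re]; ring

theorem sum_re_mul_im [DecidableEq m] (hY : Yᵀ * Y = diagonal (fun i => (d i : ℂ))) (l : m) :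
    ∑ i, (Y i l).re * (Y i l).im = 0 := by
  have := congrArg Complex.im (congrFun (congrFun hY l) l)
  rw [mul_apply, diagonal_apply_eq, Complex.ofReal_im, Complex.im_sum] at this
  have h2 : ∑ i, 2 * ((Y i l).re * (Y i l).im) = 0 := by
    rw [← this]
    exact Finset.sum_congr rfl fun i _ => by
      rw [transpose_apply, Complex.mul_im]; ring
  rw [← Finset.mul_sum] at h2
  linarith

theorem sum_sq_add_sq [Fintype m] (htr : (Y * Yᴴ).trace = 1) :
    ∑ l, ∑ i, ((Y i l).re ^ 2 + (Y i l).im ^ 2) = 1 := by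
  have := congrArg Complex.re htr
  rw [trace_mul_comm, trace, Complex.re_sum, Complex.one_re] at this
  rw [← this]
  refine Finset.sum_congr rfl fun l _ => ?_
  rw [diag_apply, mul_apply, Complex.re_sum]
  refine Finset.sum_congr rfl fun i _ => ?_
  rw [conjTranspose_apply, RCLike.star_def, Complex.mul_re, Complex.conj_re, Complex.conj_im]
  ring

theorem sum_re_sq [Fintype m] [DecidableEq m] (hY : Yᵀ * Y = diagonal (fun i => (d i : ℂ))) (htr : (Y * Yᴴ).trace = 1) :
    ∑ l, ∑ i, (Y i l).re ^ 2 = (1 + ∑ l, d l) / 2 := by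
  have h1 := sum_sq_add_sq htr
  have h2 : ∑ l, ∑ i, ((Y i l).re ^ 2 - (Y i l).im ^ 2) = ∑ l, d l :=
    Finset.sum_congr rfl fun l _ => sum_sq_sub_sq hY l
  simp only [Finset.sum_add_distrib, Finset.sum_sub_distrib] at h1 h2
  linarith

theorem sum_im_sq [Fintype m] [DecidableEq m] (hY : Yᵀ * Y = diagonal (fun i => (d i : ℂ))) (htr : (Y * Yᴴ).trace = 1) :
    ∑ l, ∑ i, (Y i l).im ^ 2 = (1 - ∑ l, d l) / 2 := by
  have h1 := sum_sq_add_sq htr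
  have h2 := sum_re_sq hY htr
  simp only [Finset.sum_add_distrib] at h1
  linarith

theorem sum_weights_le_one [Fintype m] [DecidableEq m] (hY : Yᵀ * Y = diagonal (fun i => (d i : ℂ)))
    (htr : (Y * Yᴴ).trace = 1) : ∑ l, d l ≤ 1 := by
  have h1 := sum_im_sq hY htr
  have h2 : 0 ≤ ∑ l, ∑ i, (Y i l).im ^ 2 :=
    Finset.sum_nonneg fun l _ => Finset.sum_nonneg fun i _ => sq_nonneg _
  linarith

/-- The imaginary parts have total squared norm `(1 - ∑ d) / 2`, so they all vanish. -/
theorem isReal_of_sum_weights_eq_one [Fintype m] [DecidableEq m] (hY : Yᵀ * Y = diagonal (fun i => (d i : ℂ)))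
    (htr : (Y * Yᴴ).trace = 1) (h : ∑ l, d l = 1) : IsRealMatrix (Y * Yᴴ) := by
  have h1 := sum_im_sq hY htr
  rw [h, sub_self, zero_div,
    Finset.sum_eq_zero_iff_of_nonneg fun l _ => Finset.sum_nonneg fun i _ => sq_nonneg _] at h1
  have him : ∀ i l, (Y i l).im = 0 := fun i l => by
    have h2 := h1 l (Finset.mem_univ l)
    rw [Finset.sum_eq_zero_iff_of_nonneg fun i _ => sq_nonneg _] at h2
    exact pow_eq_zero_iff two_ne_zero |>.1 (h2 i (Finset.mem_univ i))
  intro i j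
  rw [mul_apply, Complex.im_sum]
  refine Finset.sum_eq_zero fun l _ => ?_
  simp [Complex.mul_im, him]

end RealParts

/-! ### Real operations through a qubit -/

/-- The standard qubit vector `(C, i S)`. -/
noncomputable def qubitVector (C S : ℝ) : Bool → ℂ := fun t => if t then C else Complex.I * S

/-- A real operation on a qubit preparing, from a sufficiently imaginary pure state, a state
decomposed into vectors orthogonal for the bilinear form. -/
theorem exists_qubit_operation {n m : Type*} [Fintype n] [Fintype m] [DecidableEq m]
    {Y : Matrix n m ℂ} {d : m → ℝ} (hY : Yᵀ * Y = diagonal (fun i => (d i : ℂ)))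
    (htr : (Y * Yᴴ).trace = 1) {C S a b : ℝ} (hC : 0 < C) (hS : 0 < S)
    (h1 : a ^ 2 * (1 + ∑ l, d l) + b ^ 2 * (1 - ∑ l, d l) ≤ 2 * C ^ 2)
    (h2 : a ^ 2 * (1 - ∑ l, d l) + b ^ 2 * (1 + ∑ l, d l) ≤ 2 * S ^ 2) :
    ∃ G : m × Bool → Matrix n Bool ℂ, (∀ k, IsRealMatrix (G k)) ∧ ∑ k, (G k)ᴴ * G k ≤ 1 ∧
      ∑ k, G k * vecMulVec (qubitVector C S) (star (qubitVector C S)) * (G k)ᴴ =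
        ((a ^ 2 + b ^ 2 : ℝ) : ℂ) • (Y * Yᴴ) := by
  -- `(l, true)` sends `(C, i S)` to `a y_l`, and `(l, false)` sends it to `i b y_l`; the factor `i`
  -- is invisible in the projector but exchanges the roles of real and imaginary parts.
  let g : m × Bool → Matrix n Bool ℝ := fun k => Matrix.of fun i t =>
    if k.2 then (if t then a / C * (Y i k.1).re else a / S * (Y i k.1).im)
    else (if t then -(b / C) * (Y i k.1).im else b / S * (Y i k.1).re)
  refine ⟨fun k => (g k).map Complex.ofReal, fun k i t => Complex.ofReal_im _, ?_, ?_⟩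
  · have hg : ∑ k, ((g k).map Complex.ofReal)ᴴ * (g k).map Complex.ofReal =
        diagonal fun t => ((if t then
          (a ^ 2 * (1 + ∑ l, d l) + b ^ 2 * (1 - ∑ l, d l)) / (2 * C ^ 2) else
          (a ^ 2 * (1 - ∑ l, d l) + b ^ 2 * (1 + ∑ l, d l)) / (2 * S ^ 2) : ℝ) : ℂ) := by
      have hre := sum_re_sq hY htr
      have him := sum_im_sq hY htr
      -- Real and imaginary parts of each column are orthogonal, which makes `∑ Gᴴ G` diagonal and
      -- reduces the trace condition to `h1` and `h2`.
      have hcross : ∑ l, ∑ i, (Y i l).re * (Y i l).im = 0 :=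
        Finset.sum_eq_zero fun l _ => sum_re_mul_im hY l
      have hent : ∀ t t', (∑ k, ((g k).map Complex.ofReal)ᴴ * (g k).map Complex.ofReal) t t' =
          ((∑ l, ∑ i, (g (l, true) i t * g (l, true) i t' +
            g (l, false) i t * g (l, false) i t') : ℝ) : ℂ) := fun t t' => by
        rw [Matrix.sum_apply, Fintype.sum_prod_type, Complex.ofReal_sum]
        refine Finset.sum_congr rfl fun l _ => ?_
        rw [Fintype.sum_bool, mul_apply, mul_apply, ← Finset.sum_add_distrib, Complex.ofReal_sum]
        refine Finset.sum_congr rfl fun i _ => ?_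
        simp
      ext t t'
      rw [hent]
      cases t <;> cases t'
      · rw [diagonal_apply_eq]
        congr 1
        have : ∀ l i, g (l, true) i false * g (l, true) i false +
            g (l, false) i false * g (l, false) i false =
            (a / S) ^ 2 * (Y i l).im ^ 2 + (b / S) ^ 2 * (Y i l).re ^ 2 := fun l i => by
          simp [g]; ring
        simp only [this, Finset.sum_add_distrib, ← Finset.mul_sum, hre, him]
        simp; field_simp
      · rw [diagonal_apply_ne _ (by decide), ← Complex.ofReal_zero]
        congr 1
        have : ∀ l i, g (l, true) i false * g (l, true) i true +
            g (l, false) i false * g (l, false) i true =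
            ((a / S) * (a / C) - (b / S) * (b / C)) * ((Y i l).re * (Y i l).im) := fun l i => by
          simp [g]; ring
        simp only [this, ← Finset.mul_sum, hcross, mul_zero]
      · rw [diagonal_apply_ne _ (by decide), ← Complex.ofReal_zero]
        congr 1
        have : ∀ l i, g (l, true) i true * g (l, true) i false +
            g (l, false) i true * g (l, false) i false =
            ((a / S) * (a / C) - (b / S) * (b / C)) * ((Y i l).re * (Y i l).im) := fun l i => by
          simp [g]; ring
        simp only [this, ← Finset.mul_sum, hcross, mul_zero]
      · rw [diagonal_apply_eq]
        congr 1
        have : ∀ l i, g (l, true) i true * g (l, true) i true +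
            g (l, false) i true * g (l, false) i true =
            (a / C) ^ 2 * (Y i l).re ^ 2 + (b / C) ^ 2 * (Y i l).im ^ 2 := fun l i => by
          simp [g]; ring
        simp only [this, Finset.sum_add_distrib, ← Finset.mul_sum, hre, him]
        simp; field_simp
    rw [hg, Matrix.le_iff, ← diagonal_one, diagonal_sub, posSemidef_diagonal_iff]
    intro t
    rw [sub_nonneg, ← Complex.ofReal_one, Complex.real_le_real]
    split_ifs
    · exact (div_le_one (by positivity)).2 h1
    · exact (div_le_one (by positivity)).2 h2
  · have hCc : (C : ℂ) ≠ 0 := by exact_mod_cast hC.ne'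
    have hSc : (S : ℂ) ≠ 0 := by exact_mod_cast hS.ne'
    have ht : ∀ l, (g (l, true)).map Complex.ofReal *ᵥ qubitVector C S =
        (a : ℂ) • fun i => Y i l := fun l => by
      ext i
      simp only [mulVec, dotProduct, Fintype.sum_bool, g, map_apply, of_apply, qubitVector,
        Pi.smul_apply, smul_eq_mul]
      conv_rhs => rw [← Complex.re_add_im (Y i l)]
      generalize (Y i l).re = x
      generalize (Y i l).im = y
      simp
      field_simp
    have hf : ∀ l, (g (l, false)).map Complex.ofReal *ᵥ qubitVector C S =
        (b * Complex.I : ℂ) • fun i => Y i l := fun l => by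
      ext i
      simp only [mulVec, dotProduct, Fintype.sum_bool, g, map_apply, of_apply, qubitVector,
        Pi.smul_apply, smul_eq_mul]
      conv_rhs => rw [← Complex.re_add_im (Y i l)]
      generalize (Y i l).re = x
      generalize (Y i l).im = y
      simp
      field_simp
      linear_combination (-(b : ℂ) * y) * Complex.I_mul_I
    ext i i'
    rw [Matrix.sum_apply, Fintype.sum_prod_type, Matrix.smul_apply, mul_apply, Finset.smul_sum]
    refine Finset.sum_congr rfl fun l _ => ?_
    rw [Fintype.sum_bool]
    simp only [mul_vecMulVec, vecMulVec_mul, ← star_mulVec, ht, hf, vecMulVec_apply,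
      Pi.smul_apply, Pi.star_apply, smul_eq_mul, star_mul', conjTranspose_apply, RCLike.star_def,
      Complex.conj_ofReal, Complex.conj_I]
    push_cast
    linear_combination (-(b : ℂ) ^ 2 * Y i l * (starRingEnd ℂ) (Y i' l)) * Complex.I_mul_I

/-- Real contractions rotate vectors of equal imaginarity to the same qubit vector. -/
theorem exists_real_compression {n : Type*} [Fintype n] [DecidableEq n] {v : n → ℂ} {C S : ℝ}
    (hC : 0 < C) (hS : 0 < S) (hCS : C ^ 2 + S ^ 2 = 1)
    (hv : v ⬝ᵥ v = ((C ^ 2 - S ^ 2 : ℝ) : ℂ) * (star v ⬝ᵥ v)) :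
    ∃ N : Matrix Bool n ℂ, IsRealMatrix N ∧ Nᴴ * N ≤ 1 ∧
      N * vecMulVec v (star v) * Nᴴ =
        (star v ⬝ᵥ v) • vecMulVec (qubitVector C S) (star (qubitVector C S)) := by
  rcases eq_or_ne v 0 with rfl | hv0
  · exact ⟨0, fun _ _ => rfl, by simp, by simp⟩
  set q := ∑ i, ((v i).re ^ 2 + (v i).im ^ 2) with hq
  have hqv : star v ⬝ᵥ v = (q : ℂ) := by
    rw [dotProduct, hq, Complex.ofReal_sum]
    refine Finset.sum_congr rfl fun i _ => ?_
    rw [Pi.star_apply, RCLike.star_def, ← Complex.normSq_eq_conj_mul_self, Complex.normSq_apply]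
    congr 1; ring
  have hq0 : 0 < q := by
    have := dotProduct_star_self_pos_iff.2 hv0
    rw [hqv] at this
    exact_mod_cast this
  rw [hqv] at hv ⊢
  have hre : ∑ i, ((v i).re ^ 2 - (v i).im ^ 2) = (C ^ 2 - S ^ 2) * q := by
    have := congrArg Complex.re hv
    rw [dotProduct, Complex.re_sum, ← Complex.ofReal_mul, Complex.ofReal_re] at this
    rw [← this]
    exact Finset.sum_congr rfl fun i _ => by rw [Complex.mul_re]; ring
  have him : ∑ i, (v i).re * (v i).im = 0 := by
    have := congrArg Complex.im hv
    rw [dotProduct, Complex.im_sum, ← Complex.ofReal_mul, Complex.ofReal_im] at this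
    have h2 : ∑ i, 2 * ((v i).re * (v i).im) = 0 := by
      rw [← this]
      exact Finset.sum_congr rfl fun i _ => by rw [Complex.mul_im]; ring
    rw [← Finset.mul_sum] at h2
    linarith
  simp only [Finset.sum_add_distrib, Finset.sum_sub_distrib] at hq hre
  have hx : ∑ i, (v i).re ^ 2 = C ^ 2 * q := by linear_combination (hre - hq) / 2 - q / 2 * hCS
  have hy : ∑ i, (v i).im ^ 2 = S ^ 2 * q := by linear_combination (-hre - hq) / 2 - q / 2 * hCS
  set r := √q with hr
  have hr0 : 0 < r := Real.sqrt_pos.2 hq0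
  have hrr : r ^ 2 = q := Real.sq_sqrt hq0.le
  -- The hypothesis on `vᵀ v` makes `Re v` and `Im v` orthogonal with norms `r C` and `r S`, so
  -- these rows are orthonormal.
  let N : Matrix Bool n ℝ := Matrix.of fun t i =>
    if t then (v i).re / (r * C) else (v i).im / (r * S)
  have hNN : N * Nᵀ = 1 := by
    ext t t'
    rw [mul_apply]
    cases t <;> cases t' <;> simp only [N, of_apply, transpose_apply, if_true, Bool.false_eq_true,
      if_false]
    · have : ∀ i, (v i).im / (r * S) * ((v i).im / (r * S)) = (v i).im ^ 2 * (1 / (r * S) ^ 2) :=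
        fun i => by field_simp
      simp only [this, ← Finset.sum_mul, hy, one_apply_eq, ← hrr]; field_simp
    · have : ∀ i, (v i).im / (r * S) * ((v i).re / (r * C)) =
          (v i).re * (v i).im * (1 / (r * S * (r * C))) := fun i => by field_simp
      simp only [this, ← Finset.sum_mul, him, zero_mul]; simp
    · have : ∀ i, (v i).re / (r * C) * ((v i).im / (r * S)) =
          (v i).re * (v i).im * (1 / (r * S * (r * C))) := fun i => by field_simp
      simp only [this, ← Finset.sum_mul, him, zero_mul]; simp
    · have : ∀ i, (v i).re / (r * C) * ((v i).re / (r * C)) = (v i).re ^ 2 * (1 / (r * C) ^ 2) :=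
        fun i => by field_simp
      simp only [this, ← Finset.sum_mul, hx, one_apply_eq, ← hrr]; field_simp
  set Nc := N.map Complex.ofReal with hNc
  have hNh : Ncᴴ = Nᵀ.map Complex.ofReal := by
    ext i t; simp [hNc]
  have hNN' : Nc * Ncᴴ = 1 := by
    have := congrArg (fun M => M.map Complex.ofRealHom) hNN
    simp only [Matrix.map_mul, Matrix.map_one _ (map_zero _) (map_one _)] at this
    rw [hNh]; exact this
  have hNv : Nc *ᵥ v = (r : ℂ) • qubitVector C S := by
    have hre' : ∀ t, ((Nc *ᵥ v) t).re = ∑ i, N t i * (v i).re := fun t => by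
      rw [mulVec, dotProduct, Complex.re_sum]
      exact Finset.sum_congr rfl fun i _ => Complex.re_ofReal_mul _ _
    have him' : ∀ t, ((Nc *ᵥ v) t).im = ∑ i, N t i * (v i).im := fun t => by
      rw [mulVec, dotProduct, Complex.im_sum]
      exact Finset.sum_congr rfl fun i _ => Complex.im_ofReal_mul _ _
    ext t
    refine Complex.ext ?_ ?_
    · rw [hre']
      cases t <;> simp only [N, of_apply, if_true, Bool.false_eq_true, if_false]
      · have : ∀ i, (v i).im / (r * S) * (v i).re = (v i).re * (v i).im * (1 / (r * S)) :=
          fun i => by ring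
        simp only [this, ← Finset.sum_mul, him]
        simp [qubitVector]
      · have : ∀ i, (v i).re / (r * C) * (v i).re = (v i).re ^ 2 * (1 / (r * C)) :=
          fun i => by ring
        simp only [this, ← Finset.sum_mul, hx, ← hrr]
        simp [qubitVector]
        field_simp
    · rw [him']
      cases t <;> simp only [N, of_apply, if_true, Bool.false_eq_true, if_false]
      · have : ∀ i, (v i).im / (r * S) * (v i).im = (v i).im ^ 2 * (1 / (r * S)) :=
          fun i => by ring
        simp only [this, ← Finset.sum_mul, hy, ← hrr]
        simp [qubitVector]
        field_simp
      · have : ∀ i, (v i).re / (r * C) * (v i).im = (v i).re * (v i).im * (1 / (r * C)) :=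
          fun i => by ring
        simp only [this, ← Finset.sum_mul, him]
        simp [qubitVector]
  refine ⟨Nc, fun t i => Complex.ofReal_im _, ?_, ?_⟩
  · rw [Matrix.le_iff]
    have := posSemidef_conjTranspose_mul_self (1 - Ncᴴ * Nc)
    have hP : Ncᴴ * Nc * (Ncᴴ * Nc) = Ncᴴ * Nc := by
      rw [Matrix.mul_assoc, ← Matrix.mul_assoc Nc, hNN', Matrix.one_mul]
    rwa [conjTranspose_sub, conjTranspose_mul, conjTranspose_conjTranspose, conjTranspose_one,
      Matrix.sub_mul, Matrix.mul_sub, Matrix.mul_sub, hP, Matrix.one_mul, Matrix.one_mul,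
      Matrix.mul_one, sub_self, sub_zero] at this
  · rw [mul_vecMulVec, vecMulVec_mul, ← star_mulVec, hNv, star_smul, RCLike.star_def,
      Complex.conj_ofReal, smul_vecMulVec, vecMulVec_smul, smul_smul, ← Complex.ofReal_mul, ← hrr,
      pow_two]

theorem concurrenceImaginarity_mem_Icc {n : Type*} [Fintype n] [DecidableEq n] {ρ : Matrix n n ℂ}
    (hρ : IsDensityMatrix ρ) : concurrenceImaginarity ρ ∈ Set.Icc 0 1 := by
  refine ⟨le_max_left _ _, ?_⟩
  obtain ⟨Y, d, hd, hYY, hY, -, hI⟩ := exists_bilinear_orthogonal_decomposition hρ.1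
  have hn : Nonempty n := by
    by_contra h
    rw [not_nonempty_iff] at h
    simpa [trace] using hρ.2
  obtain ⟨i₀, -, h⟩ := hI hn
  have h1 := sum_weights_le_one hY (hYY ▸ hρ.2)
  have h2 := Finset.single_le_sum (fun i _ => hd i) (Finset.mem_univ i₀)
  rw [h]
  exact max_le zero_le_one (by linarith)

theorem sqrt_fidelity_transpose_mem_Icc {n : Type*} [Fintype n] [DecidableEq n]
    {σ : Matrix n n ℂ} (hσ : IsDensityMatrix σ) : √(fidelity σ σᵀ) ∈ Set.Icc 0 1 := by
  obtain ⟨Y, d, hd, hYY, hY, hf, -⟩ := exists_bilinear_orthogonal_decomposition hσ.1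
  exact ⟨Real.sqrt_nonneg _, hf ▸ sum_weights_le_one hY (hYY ▸ hσ.2)⟩

/-- Faithfulness of the geometric measure: fidelity one would force a decomposition into real
vectors. -/
theorem sqrt_fidelity_transpose_lt_one {n : Type*} [Fintype n] [DecidableEq n]
    {σ : Matrix n n ℂ} (hσ : IsDensityMatrix σ) (hr : ¬ IsRealMatrix σ) :
    √(fidelity σ σᵀ) < 1 := by
  refine lt_of_le_of_ne (sqrt_fidelity_transpose_mem_Icc hσ).2 fun h => hr ?_
  obtain ⟨Y, d, -, hYY, hY, hf, -⟩ := exists_bilinear_orthogonal_decomposition hσ.1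
  rw [← hYY]
  exact isReal_of_sum_weights_eq_one hY (hYY ▸ hσ.2) (hf ▸ h)

theorem isDensityMatrix_traceAlice_pureState {A B : Type*} [Fintype A] [Fintype B] {ψ : A × B → ℂ}
    (hψ : ∑ x, ‖ψ x‖ ^ 2 = 1) : IsDensityMatrix (traceAlice (pureState ψ)) :=
  ⟨by rw [traceAlice_pureState]; exact posSemidef_self_mul_conjTranspose _,
    trace_traceAlice_pureState hψ⟩

/-! ### Attaining the bound -/

section Achievability

variable {A B B' : Type*} [Fintype A] [DecidableEq A] [Fintype B] [DecidableEq B]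
  [Fintype B'] [DecidableEq B'] {ψ : A × B → ℂ} {σ : Matrix B' B' ℂ}

/-- Every vector of the equalised ensemble is compressed to the qubit vector with `C² = (1 + I) / 2`
and `S² = (1 - I) / 2`. The two inequalities are the trace conditions on the subsequent qubit
operation; `I < 1` keeps `S` positive. -/
theorem mem_achievable_of_weights (hψ : ∑ x, ‖ψ x‖ ^ 2 = 1) (hσ : IsDensityMatrix σ) {α β I f : ℝ}
    (hI : concurrenceImaginarity (traceAlice (pureState ψ)) = I) (hf : √(fidelity σ σᵀ) = f)
    (hI1 : I < 1) (hα : 0 ≤ α) (hβ : 0 ≤ β) (h1 : α * (1 + f) + β * (1 - f) ≤ 1 + I)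
    (h2 : α * (1 - f) + β * (1 + f) ≤ 1 - I) : α + β ∈ achievableProbabilities ψ σ := by
  have hρ := isDensityMatrix_traceAlice_pureState hψ
  have hI0 : 0 ≤ I := hI ▸ (concurrenceImaginarity_mem_Icc hρ).1
  obtain ⟨Z, c, hc, hZZ, hZ, -, hcI⟩ := exists_bilinear_orthogonal_decomposition hρ.1
  have hB : Nonempty B := by
    by_contra h
    rw [not_nonempty_iff] at h
    simpa [trace] using hρ.2
  obtain ⟨i₀, hi₀, hcI⟩ := hcI hB
  obtain ⟨V, hV, hVI⟩ := exists_equalized_decomposition hc hZ (hZZ ▸ hρ.2) hi₀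
  rw [← hcI, hI] at hVI
  obtain ⟨Y, d, -, hYY, hY, hd, -⟩ := exists_bilinear_orthogonal_decomposition hσ.1
  rw [hf] at hd
  have hC0 : 0 < (1 + I) / 2 := by linarith
  have hS0 : 0 < (1 - I) / 2 := by linarith
  have hCC := Real.sq_sqrt hC0.le
  have hSS := Real.sq_sqrt hS0.le
  obtain ⟨G, hG, hGle, hGout⟩ := exists_qubit_operation (a := √α) (b := √β) hY (hYY ▸ hσ.2)
    (Real.sqrt_pos.2 hC0) (Real.sqrt_pos.2 hS0)
    (by rw [Real.sq_sqrt hα, Real.sq_sqrt hβ, hCC, ← hd]; linarith)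
    (by rw [Real.sq_sqrt hα, Real.sq_sqrt hβ, hSS, ← hd]; linarith)
  rw [Real.sq_sqrt hα, Real.sq_sqrt hβ, hYY] at hGout
  choose N hN hNle hNout using fun j => exists_real_compression (v := fun b => V b j)
    (Real.sqrt_pos.2 hC0) (Real.sqrt_pos.2 hS0) (by rw [hCC, hSS]; ring)
    (by
      rw [hCC, hSS, show (1 + I) / 2 - (1 - I) / 2 = I by ring]
      exact hVI j)
  refine mem_achievable_of_decomposition hψ (hV.trans hZZ) (fun j k => G k * N j)
    (fun j k i b => ?_) (fun j => ?_) fun j => ?_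
  · rw [mul_apply, Complex.im_sum]
    refine Finset.sum_eq_zero fun t _ => ?_
    rw [Complex.mul_im, hG, hN, mul_zero, zero_mul, add_zero]
  · have h3 : ∑ k, (G k * N j)ᴴ * (G k * N j) = (N j)ᴴ * (∑ k, (G k)ᴴ * G k) * N j := by
      rw [Matrix.mul_sum, Matrix.sum_mul]
      simp only [conjTranspose_mul, Matrix.mul_assoc]
    refine le_trans ?_ (hNle j)
    rw [h3, Matrix.le_iff]
    have := (Matrix.le_iff.1 hGle).conjTranspose_mul_mul_same (N j)
    rwa [Matrix.mul_sub, Matrix.sub_mul, Matrix.mul_one] at this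
  · have h3 : ∀ k, G k * N j * vecMulVec (fun b => V b j) (star fun b => V b j) * (G k * N j)ᴴ =
        (Vᴴ * V) j j • (G k * vecMulVec (qubitVector √((1 + I) / 2) √((1 - I) / 2))
          (star (qubitVector √((1 + I) / 2) √((1 - I) / 2))) * (G k)ᴴ) := fun k => by
      calc _ = G k * (N j * vecMulVec (fun b => V b j) (star fun b => V b j) * (N j)ᴴ) *
            (G k)ᴴ := by simp only [conjTranspose_mul, Matrix.mul_assoc]
        _ = _ := by rw [hNout, Matrix.mul_smul, Matrix.smul_mul]; rfl
    simp only [h3]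
    rw [← Finset.smul_sum, hGout, smul_smul, mul_comm]

theorem isGreatest_achievable (hψ : ∑ x, ‖ψ x‖ ^ 2 = 1) (hσ : IsDensityMatrix σ)
    (hlt : √(fidelity σ σᵀ) < 1) :
    IsGreatest (achievableProbabilities ψ σ)
      (min ((1 - concurrenceImaginarity (traceAlice (pureState ψ))) /
        (1 - √(fidelity σ σᵀ))) 1) := by
  have hI := concurrenceImaginarity_mem_Icc (isDensityMatrix_traceAlice_pureState hψ)
  have hf0 := (sqrt_fidelity_transpose_mem_Icc hσ).1
  refine ⟨?_, fun p hp => ?_⟩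
  · generalize hIe : concurrenceImaginarity (traceAlice (pureState ψ)) = I at hI ⊢
    generalize hfe : √(fidelity σ σᵀ) = f at hlt hf0 ⊢
    obtain ⟨hI0, hI1⟩ := hI
    have hf1 : 0 < 1 - f := by linarith
    rcases hI1.eq_or_lt with rfl | hI1
    · rw [sub_self, zero_div, min_eq_left zero_le_one]
      exact zero_mem_achievable ψ σ
    -- If `f ≤ I`, the direct branch alone suffices and the second trace condition is tight.
    -- Otherwise the branch with factor `i` is mixed in.
    rcases le_or_gt f I with h | h
    · have hle : (1 - I) / (1 - f) ≤ 1 := (div_le_one hf1).2 (by linarith)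
      have h0 : 0 ≤ (1 - I) / (1 - f) := div_nonneg (by linarith) hf1.le
      have hm : (1 - I) / (1 - f) * (1 - f) = 1 - I := div_mul_cancel₀ _ hf1.ne'
      rw [min_eq_left hle]
      have := mem_achievable_of_weights hψ hσ hIe hfe hI1 h0 le_rfl (by nlinarith) (by linarith)
      rwa [add_zero] at this
    · have hle : 1 ≤ (1 - I) / (1 - f) := (one_le_div hf1).2 (by linarith)
      have hf : 0 < f := by linarith
      have hr0 : 0 ≤ I / f := div_nonneg hI0 hf.le
      have hr1 : I / f ≤ 1 := (div_le_one hf).2 h.le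
      have hm : I / f * f = I := div_mul_cancel₀ _ hf.ne'
      rw [min_eq_right hle]
      -- These weights solve `α + β = 1` and `(α - β) f = I`, which makes both trace conditions
      -- equalities.
      have := mem_achievable_of_weights (α := (1 + I / f) / 2) (β := (1 - I / f) / 2) hψ hσ hIe hfe
        hI1 (by linarith) (by linarith) (by nlinarith) (by nlinarith)
      rwa [show (1 + I / f) / 2 + (1 - I / f) / 2 = 1 by ring] at this
  · obtain ⟨h1, h2⟩ := achievable_bound hψ hσ hp
    exact le_min ((le_div_iff₀ (by linarith)).2 h2) h1

end Achievability

end Imaginarity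

theorem lemma1 {A B B' : Type*} [Fintype A] [DecidableEq A] [Fintype B] [DecidableEq B]
    [Fintype B'] [DecidableEq B']
    (ψ : A × B → ℂ) (hψ : ∑ x, ‖ψ x‖ ^ 2 = 1)
    (σ : Matrix B' B' ℂ) (hσ : Imaginarity.IsDensityMatrix σ) :
    (∀ α β : ℝ, α ∈ Set.Ico 0 (Real.pi / 2) → β ∈ Set.Ioo 0 (Real.pi / 2) →
      Real.sin α ^ 2 = (1 - Imaginarity.concurrenceImaginarity
        (Imaginarity.traceAlice (Imaginarity.pureState ψ))) / 2 →
      Real.sin β ^ 2 = Imaginarity.geometricImaginarity σ →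
      IsGreatest (Imaginarity.achievableProbabilities ψ σ)
        (min (Real.sin α ^ 2 / Real.sin β ^ 2) 1)) ∧
    (¬ Imaginarity.IsRealMatrix σ →
      IsGreatest (Imaginarity.achievableProbabilities ψ σ)
        (min ((1 - Imaginarity.concurrenceImaginarity
            (Imaginarity.traceAlice (Imaginarity.pureState ψ))) /
          (1 - Real.sqrt (Imaginarity.fidelity σ σ.transpose))) 1)) ∧
    (Imaginarity.IsRealMatrix σ →
      IsGreatest (Imaginarity.achievableProbabilities ψ σ) 1) := by
  refine ⟨fun α β _ hβ hsα hsβ => ?_, fun hr => ?_, fun hr => ?_⟩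
  · have hpos : 0 < Real.sin β ^ 2 :=
      pow_pos (Real.sin_pos_of_pos_of_lt_pi hβ.1 (by linarith [hβ.2, Real.pi_pos])) 2
    rw [hsβ, Imaginarity.geometricImaginarity] at hpos
    rw [hsα, hsβ, Imaginarity.geometricImaginarity, div_div_div_cancel_right₀ two_ne_zero]
    exact Imaginarity.isGreatest_achievable hψ hσ (by linarith)
  · exact Imaginarity.isGreatest_achievable hψ hσ
      (Imaginarity.sqrt_fidelity_transpose_lt_one hσ hr)
  · exact ⟨Imaginarity.one_mem_achievable_of_real hψ hσ hr,
      fun p hp => (Imaginarity.achievable_bound hψ hσ hp).1⟩
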